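/- Let $(W,S)$ be a Coxeter system with length function $l$, Bruhat order $\le$ and left weak order $\le_L$ (the transitive closure of the relation: $w=su$ with $s\in S\cup\{1\}$ and $l(u)\le l(w)$). Let $\mathcal A=\mathbb Z[q,q^{-1}]$, and let $a\mapsto\overline a$ be the involution of $\mathcal A$ with $\overline q=q^{-1}$. Let $\mathcal H=\mathcal H(W)$ be the Hecke algebra over $\mathcal A$, with generators $T_s$ ($s\in S$), the relations $T_s^2=1+(q-q^{-1})T_s$ and the braid relations. It carries the bar involution, which extends that of $\mathcal A$ and satisfies $\overline{T_s}=T_s^{-1}=T_s-(q-q^{-1})$. For $J\subseteq S$ let $W_J=\langle J\rangle$ and $D_J=\{w\in W: l(ws)>l(w)\text{ for all }s\in J\}$. A set $\mathscr I\subseteq W$ containing $1$ is called a *$W$-graph ideal with respect to $J$* if $\mathscr I$ is an ideal (down-set) of $(W,\le_L)$, if $J\subseteq S$ with $\mathscr I\subseteq D_J$, and if there is an $\mathcal H$-module $\mathscr S$ with the following two properties. (i) $\mathscr S$ has an $\mathcal A$-basis $(b_w)_{w\in\mathscr I}$ such that for all $s\in S$ and $w\in\mathscr I$ $$T_sb_w=\begin{cases}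 b_{sw}&\text{if } sw>w,\ sw\in\mathscr I,\\ b_{sw}+(q-q^{-1})b_w&\text{if } sw<w,\\ -q^{-1}b_w&\text{if } sw>w,\ sw\notin D_J,\\ qb_w-\sum_{y\in\mathscr I,\,y<sw}r^s_{y,w}b_y&\text{if } sw>w,\ sw\in D_J\setminus\mathscr I, \end{cases}$$ for some polynomials $r^s_{y,w}\in q\mathbb Z[q]$. (ii) $\mathscr S$ admits an $\mathcal A$-semilinear involution $\alpha\mapsto\overline\alpha$ with $\overline{b_1}=b_1$ and $\overline{h\alpha}=\overline h\,\overline\alpha$ for all $h\in\mathcal H$ and $\alpha\in\mathscr S$. Any module $\mathscr S$ with the properties (i) and (ii) is called a module $\mathscr S(\mathscr I,J)$ associated with $\mathscr I$ and $J$. For $K\subseteq S$, the same definitions apply to the Coxeter system $(W_K,K)$ and its Hecke algebra $\mathcal H_K=\mathcal H(W_K)$, which maps to $\mathcal H$ by $T_s\mapsto T_s$ ($s\in K$). **Theorem.** Let $J\subseteq K\subseteq S$, let $\mathscr I_0\subseteq W_K$ be a $W_K$-graph ideal with respect to $J$, and let $\mathscr S_0$ be an associated $\mathcal H_K$-module $\mathscr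 S(\mathscr I_0,J)$. Then $\mathscr I=D_K\mathscr I_0=\{dz: d\in D_K,\ z\in\mathscr I_0\}$ is a $W$-graph ideal with respect to $J$. Moreover, the induced module $\mathcal H\otimes_{\mathcal H_K}\mathscr S_0$ is an associated module $\mathscr S(\mathscr I,J)$, and every $\mathcal H$-module $\mathscr S(\mathscr I,J)$ associated with $\mathscr I$ and $J$ is isomorphic to $\mathcal H\otimes_{\mathcal H_K}\mathscr S_0$. -/

import Mathlib

open scoped LaurentPolynomial Polynomial

namespace WGraph

universe u v

section Group

variable {G : Type u} [Group G]

/-- The length of `g` relative to the generating set `S`: the least length of a word in `S`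
with product `g`. -/
noncomputable def len (S : Set G) (g : G) : ℕ :=
  sInf {n | ∃ ω : List G, (∀ x ∈ ω, x ∈ S) ∧ ω.length = n ∧ ω.prod = g}

/-- For a Coxeter system, `len` is Mathlib's length function. -/
theorem len_eq_length {B W : Type*} [Group W] {M : CoxeterMatrix B} (cs : CoxeterSystem M W)
    (w : W) : len (Set.range cs.simple) w = cs.length w := by
  have key : ∀ n, (∃ ω : List W, (∀ x ∈ ω, x ∈ Set.range cs.simple) ∧ ω.length = n ∧ ω.prod = w) ↔
      ∃ ω : List B, ω.length = n ∧ cs.wordProd ω = w := by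
    intro n
    constructor
    · rintro ⟨ω, h, rfl, rfl⟩
      obtain ⟨ω', rfl⟩ : ∃ ω' : List B, ω'.map cs.simple = ω := by
        have := (Set.range_list_map cs.simple)
        have h2 : ω ∈ Set.range (List.map cs.simple) := by rw [this]; exact h
        exact h2
      exact ⟨ω', by simp, rfl⟩
    · rintro ⟨ω, rfl, rfl⟩
      exact ⟨ω.map cs.simple, by simp, by simp, rfl⟩
  apply le_antisymm
  · obtain ⟨ω, h1, h2⟩ := cs.exists_isReduced w
    exact Nat.sInf_le ((key _).2 ⟨ω, by rw [h2]; exact h1.symm, h2.symm⟩)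
  · obtain ⟨ω, h1, h2⟩ := cs.exists_isReduced w
    have hne : {n | ∃ ω : List W, (∀ x ∈ ω, x ∈ Set.range cs.simple) ∧ ω.length = n ∧
        ω.prod = w}.Nonempty :=
      ⟨ω.length, (key _).2 ⟨ω, rfl, h2.symm⟩⟩
    obtain ⟨ω', h3, h4⟩ := (key _).1 (Nat.sInf_mem hne)
    change _ ≤ sInf _
    rw [← h3, ← h4]; exact cs.length_wordProd_le ω'

/-- The set of reflections: all conjugates of elements of `S`. -/
def reflections (S : Set G) : Set G := {t | ∃ s ∈ S, ∃ w : G, t = w⁻¹ * s * w}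

/-- The Bruhat order: the transitive closure of `u → w` iff `l(u) ≤ l(w)` and `w = t u`
for a reflection `t` or `t = 1`. -/
def BruhatLE (S : Set G) : G → G → Prop :=
  Relation.TransGen fun u w => len S u ≤ len S w ∧ ∃ t, (t ∈ reflections S ∨ t = 1) ∧ w = t * u

def BruhatLT (S : Set G) (u w : G) : Prop := BruhatLE S u w ∧ u ≠ w

/-- The left weak order: the transitive closure of `u → w` iff `l(u) ≤ l(w)` and `w = s u`
for some `s ∈ S` or `s = 1`. -/
def WeakLE (S : Set G) : G → G → Prop :=
  Relation.TransGen fun u w => len S u ≤ len S w ∧ ∃ s, (s ∈ S ∨ s = 1) ∧ w = s * u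

/-- `D_J`, the distinguished (minimal) left coset representatives for `W_J`. -/
def minReps (S J : Set G) : Set G := {w | ∀ s ∈ J, len S w < len S (w * s)}

/-- `Pos(X)`. -/
def posSet (S X : Set G) : Set G := {s | s ∈ S ∧ ∀ x ∈ X, len S x < len S (x * s)}

/-- `I` is an ideal (down-set) for the left weak order. -/
def IsWeakIdeal (S I : Set G) : Prop := ∀ u w, WeakLE S u w → w ∈ I → u ∈ I

/-- Strong ascents of `w`. -/
def strongAscents (S I : Set G) (w : G) : Set G :=
  {s | s ∈ S ∧ BruhatLT S w (s * w) ∧ s * w ∈ I}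

/-- Strong descents of `w`. -/
def strongDescents (S : Set G) (w : G) : Set G := {s | s ∈ S ∧ BruhatLT S (s * w) w}

/-- Weak ascents of `w`. -/
def weakAscents (S I J : Set G) (w : G) : Set G :=
  {s | s ∈ S ∧ BruhatLT S w (s * w) ∧ s * w ∈ minReps S J ∧ s * w ∉ I}

/-- Weak descents of `w`. -/
def weakDescents (S J : Set G) (w : G) : Set G :=
  {s | s ∈ S ∧ BruhatLT S w (s * w) ∧ s * w ∉ minReps S J}

end Group

section Parabolic

variable {W : Type u} [Group W]

/-- The standard parabolic subgroup `W_K`. -/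
abbrev parabolic (K : Set W) : Subgroup W := Subgroup.closure K

/-- A set of elements of `W`, seen inside the subgroup `W_K`. -/
def within (K X : Set W) : Set (parabolic K) := {x | (x : W) ∈ X}

/-- The set `D_K I₀ = {d z : d ∈ D_K, z ∈ I₀}`, for `I₀ ⊆ W_K`. -/
def inducedIdeal (S K : Set W) (I₀ : Set (parabolic K)) : Set W :=
  {w | ∃ d ∈ minReps S K, ∃ z ∈ I₀, w = d * (z : W)}

end Parabolic

section AltProd

/-- `x y x y ⋯` with `n` factors. -/
def altProd {R : Type u} [Monoid R] (x y : R) : ℕ → R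
  | 0 => 1
  | n + 1 => x * altProd y x n

theorem map_altProd {R : Type u} {R' : Type v} [Monoid R] [Monoid R'] {F : Type*}
    [FunLike F R R'] [MonoidHomClass F R R'] (f : F) (x y : R) (n : ℕ) :
    f (altProd x y n) = altProd (f x) (f y) n := by
  induction n generalizing x y with
  | zero => simp [altProd]
  | succ n ih => simp [altProd, ih]

theorem altProd_succ_last {R : Type u} [Monoid R] (x y : R) (n : ℕ) :
    altProd x y (n + 1) = altProd x y n * (if Even n then x else y) := by
  induction n generalizing x y with
  | zero => simp [altProd]
  | succ n ih =>
    rw [altProd, ih y x, altProd, mul_assoc]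
    by_cases h : Even n <;> simp [h, Nat.even_add_one]

theorem altProd_inv {R : Type u} [Group R] (x y : R) (n : ℕ) :
    (altProd x y n)⁻¹ = if Even n then altProd y⁻¹ x⁻¹ n else altProd x⁻¹ y⁻¹ n := by
  induction n with
  | zero => simp [altProd]
  | succ n ih =>
    rw [altProd_succ_last, mul_inv_rev, ih]
    by_cases h : Even n <;> simp [h, Nat.even_add_one, altProd]

theorem altProd_inv_comm {R : Type u} [Group R] {x y : R} {n : ℕ}
    (h : altProd x y n = altProd y x n) : altProd x⁻¹ y⁻¹ n = altProd y⁻¹ x⁻¹ n := by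
  have h' := congrArg (·⁻¹) h
  simp only [altProd_inv] at h'
  split_ifs at h'
  · exact h'.symm
  · exact h'

end AltProd

section Hecke

/-- The indeterminate `q` of `𝒜 = ℤ[q, q⁻¹]`. -/
noncomputable abbrev q : ℤ[T;T⁻¹] := LaurentPolynomial.T 1

/-- The element `q⁻¹` of `𝒜`. -/
noncomputable abbrev qinv : ℤ[T;T⁻¹] := LaurentPolynomial.T (-1)

/-- The involution of `𝒜` with `q ↦ q⁻¹`. -/
noncomputable def barA : ℤ[T;T⁻¹] →+* ℤ[T;T⁻¹] :=
  (LaurentPolynomial.invert (R := ℤ)).toRingEquiv.toRingHom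

theorem barA_q : barA q = qinv := by
  simp [barA]

theorem barA_qinv : barA qinv = q := by
  simp [barA]

variable {G : Type u} [Group G]

/-- The defining relations of the Hecke algebra of `(G, S)`; the braid relation has `m(s, t)`
factors on each side, `m(s, t)` being the order of `s t` (it is vacuous if the order is infinite,
for which `orderOf` is `0`). -/
inductive HeckeRel (S : Set G) : FreeAlgebra ℤ[T;T⁻¹] S → FreeAlgebra ℤ[T;T⁻¹] S → Prop
  | quadratic (s : S) : HeckeRel S (FreeAlgebra.ι _ s * FreeAlgebra.ι _ s)
      (1 + (q - qinv) • FreeAlgebra.ι _ s)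
  | braid (s t : S) : HeckeRel S
      (altProd (FreeAlgebra.ι _ s) (FreeAlgebra.ι _ t) (orderOf ((s : G) * (t : G))))
      (altProd (FreeAlgebra.ι _ t) (FreeAlgebra.ι _ s) (orderOf ((s : G) * (t : G))))

/-- The Hecke algebra of `(G, S)` over `ℤ[q, q⁻¹]`. -/
def Hecke (S : Set G) : Type u := RingQuot (HeckeRel S)

noncomputable instance (S : Set G) : Ring (Hecke S) :=
  inferInstanceAs (Ring (RingQuot (HeckeRel S)))

noncomputable instance (S : Set G) : Algebra ℤ[T;T⁻¹] (Hecke S) :=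
  inferInstanceAs (Algebra ℤ[T;T⁻¹] (RingQuot (HeckeRel S)))

/-- The quotient map onto the Hecke algebra. -/
noncomputable def toHecke (S : Set G) : FreeAlgebra ℤ[T;T⁻¹] S →ₐ[ℤ[T;T⁻¹]] Hecke S :=
  RingQuot.mkAlgHom ℤ[T;T⁻¹] (HeckeRel S)

theorem toHecke_rel (S : Set G) {x y : FreeAlgebra ℤ[T;T⁻¹] S} (h : HeckeRel S x y) :
    toHecke S x = toHecke S y :=
  RingQuot.mkAlgHom_rel ℤ[T;T⁻¹] h

/-- The generators `T_s`. -/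
noncomputable def gen (S : Set G) (s : S) : Hecke S :=
  toHecke S (FreeAlgebra.ι _ s)

theorem gen_mul_gen (S : Set G) (s : S) :
    gen S s * gen S s = 1 + (q - qinv) • gen S s := by
  have h := toHecke_rel S (HeckeRel.quadratic s)
  simp only [map_mul, map_add, map_one, map_smul] at h
  exact h

theorem gen_braid (S : Set G) (s t : S) :
    altProd (gen S s) (gen S t) (orderOf ((s : G) * (t : G))) =
      altProd (gen S t) (gen S s) (orderOf ((s : G) * (t : G))) := by
  have h := toHecke_rel S (HeckeRel.braid s t)
  simp only [map_altProd] at h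
  exact h

/-- `T_s` as a unit, with inverse `T_s - (q - q⁻¹)`. -/
noncomputable def genUnit (S : Set G) (s : S) : (Hecke S)ˣ where
  val := gen S s
  inv := gen S s - (q - qinv) • (1 : Hecke S)
  val_inv := by rw [mul_sub, gen_mul_gen, mul_smul_comm, mul_one, add_sub_cancel_right]
  inv_val := by rw [sub_mul, gen_mul_gen, smul_mul_assoc, one_mul, add_sub_cancel_right]

/-- The ring homomorphism on a free algebra that extends a central ring homomorphism `φ` on the
scalars and a map `f` on the generators. -/
noncomputable def semilift {A X R : Type*} [CommRing A] [Ring R] (φ : A →+* R)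
    (hφ : ∀ c x, φ c * x = x * φ c) (f : X → R) : FreeAlgebra A X →+* R :=
  letI := φ.toAlgebra' hφ
  (FreeAlgebra.lift A f).toRingHom

theorem semilift_ι {A X R : Type*} [CommRing A] [Ring R] (φ : A →+* R)
    (hφ : ∀ c x, φ c * x = x * φ c) (f : X → R) (x : X) :
    semilift φ hφ f (FreeAlgebra.ι A x) = f x :=
  letI := φ.toAlgebra' hφ
  FreeAlgebra.lift_ι_apply (R := A) f x

theorem semilift_algebraMap {A X R : Type*} [CommRing A] [Ring R] (φ : A →+* R)
    (hφ : ∀ c x, φ c * x = x * φ c) (f : X → R) (a : A) :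
    semilift φ hφ f (algebraMap A _ a) = φ a :=
  letI := φ.toAlgebra' hφ
  (FreeAlgebra.lift A f).commutes a

/-- The ring homomorphism on the free algebra underlying the bar involution: it is semilinear
for `q ↦ q⁻¹` and sends the generator of index `s` to `T_s⁻¹`. -/
noncomputable def preBar (S : Set G) : FreeAlgebra ℤ[T;T⁻¹] S →+* Hecke S :=
  semilift ((algebraMap ℤ[T;T⁻¹] (Hecke S)).comp barA)
    (fun c x => Algebra.commutes (barA c) x)
    (fun s => ((genUnit S s)⁻¹ : (Hecke S)ˣ).val)

theorem preBar_ι (S : Set G) (s : S) :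
    preBar S (FreeAlgebra.ι _ s) = ((genUnit S s)⁻¹ : (Hecke S)ˣ).val :=
  semilift_ι _ _ _ s

theorem preBar_algebraMap (S : Set G) (a : ℤ[T;T⁻¹]) :
    preBar S (algebraMap _ _ a) = algebraMap _ (Hecke S) (barA a) :=
  semilift_algebraMap _ _ _ a

theorem preBar_rel (S : Set G) ⦃x y : FreeAlgebra ℤ[T;T⁻¹] S⦄ (h : HeckeRel S x y) :
    preBar S x = preBar S y := by
  cases h with
  | quadratic s =>
    rw [Algebra.smul_def, map_mul, map_add, map_one, map_mul, preBar_algebraMap, preBar_ι,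
      map_sub barA, barA_q, barA_qinv, ← Algebra.smul_def]
    have h2 : ((genUnit S s)⁻¹ : (Hecke S)ˣ).val = gen S s - (q - qinv) • (1 : Hecke S) := rfl
    have h1 : ((genUnit S s)⁻¹ : (Hecke S)ˣ).val * gen S s = 1 := (genUnit S s).inv_val
    have h3 : gen S s = ((genUnit S s)⁻¹ : (Hecke S)ˣ).val + (q - qinv) • (1 : Hecke S) := by
      rw [h2, sub_add_cancel]
    rw [h3, mul_add, mul_smul_comm, mul_one] at h1
    rw [eq_sub_of_add_eq h1, sub_eq_add_neg, ← neg_smul, neg_sub]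
  | braid s t =>
    rw [map_altProd, map_altProd, preBar_ι, preBar_ι]
    have h : altProd (genUnit S s) (genUnit S t) (orderOf ((s : G) * (t : G))) =
        altProd (genUnit S t) (genUnit S s) (orderOf ((s : G) * (t : G))) := by
      apply Units.ext
      have e := map_altProd (Units.coeHom (Hecke S))
      simp only [Units.coeHom_apply] at e
      rw [e, e]
      exact gen_braid S s t
    have h' := congrArg (Units.coeHom (Hecke S)) (altProd_inv_comm h)
    rwa [map_altProd, map_altProd] at h'

/-- The bar involution of the Hecke algebra. -/
noncomputable def bar (S : Set G) : Hecke S →+* Hecke S :=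
  RingQuot.lift ⟨preBar S, preBar_rel S⟩

theorem bar_toHecke (S : Set G) (x : FreeAlgebra ℤ[T;T⁻¹] S) :
    bar S (toHecke S x) = preBar S x := by
  have h := RingQuot.lift_mkRingHom_apply (preBar S) (preBar_rel S) x
  rw [← RingQuot.mkAlgHom_coe ℤ[T;T⁻¹]] at h
  exact h

theorem bar_gen (S : Set G) (s : S) :
    bar S (gen S s) = gen S s - (q - qinv) • (1 : Hecke S) := by
  rw [gen, bar_toHecke, preBar_ι]
  rfl

theorem bar_algebraMap (S : Set G) (a : ℤ[T;T⁻¹]) :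
    bar S (algebraMap _ (Hecke S) a) = algebraMap _ (Hecke S) (barA a) := by
  rw [← AlgHom.commutes (toHecke S) a, bar_toHecke, preBar_algebraMap]

end Hecke

section HeckeParabolic

variable {W : Type u} [Group W]

/-- The generator of index `s` of the free algebra on `K`, sent to `T_s` in `ℋ`. -/
noncomputable def preIncl {S K : Set W} (hK : K ⊆ S) :
    FreeAlgebra ℤ[T;T⁻¹] (within K K) →ₐ[ℤ[T;T⁻¹]] Hecke S :=
  FreeAlgebra.lift _ fun s => gen S ⟨((s : parabolic K) : W), hK s.2⟩

theorem preIncl_rel {S K : Set W} (hK : K ⊆ S) ⦃x y : FreeAlgebra ℤ[T;T⁻¹] (within K K)⦄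
    (h : HeckeRel (within K K) x y) : preIncl hK x = preIncl hK y := by
  cases h with
  | quadratic s =>
    simp only [map_mul, map_add, map_one, map_smul, preIncl, FreeAlgebra.lift_ι_apply]
    exact gen_mul_gen S _
  | braid s t =>
    have e : orderOf ((s : parabolic K) * (t : parabolic K)) =
        orderOf (((s : parabolic K) : W) * ((t : parabolic K) : W)) := by
      rw [← Subgroup.orderOf_coe, Subgroup.coe_mul]
    rw [map_altProd, map_altProd, e]
    simp only [preIncl, FreeAlgebra.lift_ι_apply]
    exact gen_braid S ⟨_, hK s.2⟩ ⟨_, hK t.2⟩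

/-- The canonical homomorphism `ℋ_K = ℋ(W_K) → ℋ = ℋ(W)` with `T_s ↦ T_s` for `s ∈ K`. -/
noncomputable def heckeIncl {S K : Set W} (hK : K ⊆ S) :
    Hecke (within K K) →ₐ[ℤ[T;T⁻¹]] Hecke S :=
  RingQuot.liftAlgHom ℤ[T;T⁻¹] ⟨preIncl hK, preIncl_rel hK⟩

theorem heckeIncl_gen {S K : Set W} (hK : K ⊆ S) (s : within K K) :
    heckeIncl hK (gen (within K K) s) = gen S ⟨((s : parabolic K) : W), hK s.2⟩ := by
  have h := RingQuot.liftAlgHom_mkAlgHom_apply ℤ[T;T⁻¹] (preIncl hK) (preIncl_rel hK)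
    (FreeAlgebra.ι _ s)
  simp only [preIncl, FreeAlgebra.lift_ι_apply] at h
  exact h

open scoped TensorProduct in
/-- The submodule of relations `h k ⊗ m = h ⊗ k m` (`h ∈ ℋ`, `k ∈ ℋ_K`) in `ℋ ⊗_𝒜 𝒮₀`. -/
noncomputable def inducedRel {S K : Set W} (hK : K ⊆ S) (𝒮₀ : Type v) [AddCommGroup 𝒮₀]
    [Module ℤ[T;T⁻¹] 𝒮₀] [Module (Hecke (within K K)) 𝒮₀] :
    Submodule (Hecke S) (Hecke S ⊗[ℤ[T;T⁻¹]] 𝒮₀) :=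
  Submodule.span (Hecke S) {x | ∃ (h : Hecke S) (k : Hecke (within K K)) (m : 𝒮₀),
    x = (h * heckeIncl hK k) ⊗ₜ[ℤ[T;T⁻¹]] m - h ⊗ₜ[ℤ[T;T⁻¹]] (k • m)}

open scoped TensorProduct in
/-- The induced module `ℋ ⊗_{ℋ_K} 𝒮₀`, as the quotient of `ℋ ⊗_𝒜 𝒮₀` by the relations
`h k ⊗ m = h ⊗ k m` (Mathlib has tensor products over commutative rings only). -/
abbrev Induced {S K : Set W} (hK : K ⊆ S) (𝒮₀ : Type v) [AddCommGroup 𝒮₀]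
    [Module ℤ[T;T⁻¹] 𝒮₀] [Module (Hecke (within K K)) 𝒮₀] : Type (max u v) :=
  (Hecke S ⊗[ℤ[T;T⁻¹]] 𝒮₀) ⧸ inducedRel hK 𝒮₀

end HeckeParabolic

section Ideal

variable {G : Type u} [Group G]

/-- The basis `(b_w : w ∈ I)` of the `ℋ`-module `𝒮` satisfies the two conditions in the definition
of a `W`-graph ideal with respect to `J`: the formulas for the action of the generators `T_s`, and
the existence of the semilinear involution. In the formula for weak ascents the polynomials
`r y ∈ q ℤ[q]` are indexed by the `y ∈ I` with `y < s w`, of which there are finitely many. -/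
structure IsWGraphIdealBasis (S I J : Set G) {𝒮 : Type v} [AddCommGroup 𝒮] [Module ℤ[T;T⁻¹] 𝒮]
    [Module (Hecke S) 𝒮] (b : Module.Basis I ℤ[T;T⁻¹] 𝒮) : Prop where
  strong_ascent : ∀ (s : S) (w : I), (s : G) ∈ strongAscents S I w →
    ∃ h : (s : G) * w ∈ I, gen S s • b w = b ⟨s * w, h⟩
  strong_descent : ∀ (s : S) (w : I), (s : G) ∈ strongDescents S (w : G) →
    ∃ h : (s : G) * w ∈ I, gen S s • b w = b ⟨s * w, h⟩ + (q - qinv) • b w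
  weak_descent : ∀ (s : S) (w : I), (s : G) ∈ weakDescents S J (w : G) →
    gen S s • b w = -qinv • b w
  weak_ascent : ∀ (s : S) (w : I), (s : G) ∈ weakAscents S I J w →
    ∃ r : I →₀ ℤ[X], (∀ y ∈ r.support, BruhatLT S (y : G) (s * w)) ∧
      (∀ y, (r y).coeff 0 = 0) ∧
      gen S s • b w = q • b w - r.sum fun y p => Polynomial.toLaurent p • b y
  involution : ∃ β : 𝒮 →ₛₗ[barA] 𝒮, Function.Involutive β ∧
    (∃ h : (1 : G) ∈ I, β (b ⟨1, h⟩) = b ⟨1, h⟩) ∧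
    ∀ (h : Hecke S) (α : 𝒮), β (h • α) = bar S h • β α

/-- `𝒮` is a module `𝒮(I, J)` associated with the `W`-graph ideal `I` and the set `J`. -/
def IsWGraphIdealModule (S I J : Set G) (𝒮 : Type v) [AddCommGroup 𝒮] [Module ℤ[T;T⁻¹] 𝒮]
    [Module (Hecke S) 𝒮] : Prop :=
  ∃ b : Module.Basis I ℤ[T;T⁻¹] 𝒮, IsWGraphIdealBasis S I J b

/-- `I` is a `W`-graph ideal with respect to `J`. -/
def IsWGraphIdeal (S I J : Set G) : Prop :=
  IsWeakIdeal S I ∧ J ⊆ posSet S I ∧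
    ∃ (𝒮 : Type u) (_ : AddCommGroup 𝒮) (_ : Module ℤ[T;T⁻¹] 𝒮) (_ : Module (Hecke S) 𝒮)
      (_ : IsScalarTower ℤ[T;T⁻¹] (Hecke S) 𝒮), IsWGraphIdealModule S I J 𝒮

end Ideal

end WGraph

/-! Every element of `W` is uniquely `d z` with `d ∈ D_K` and `z ∈ W_K`, and lengths add. Hence
`T_{dz} = T_d T_z`, the algebra `ℋ` is free as a right `ℋ_K`-module on the `T_d`, and the induced
module is the direct sum of the `T_d ⊗ 𝒮₀`, with basis `T_d ⊗ b_z` indexed by `D_K I₀` (`indEquiv`,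
`indBasis`).

The action of `T_s` on this basis is governed by Deodhar's lemma (`simple_mul_mem_minReps_or`). If
`s d ∈ D_K`, then `T_s` only moves `d`, and `s` is a strong ascent or descent. Otherwise `s d = d t`
with `t ∈ K`, so `T_s T_d = T_d T_t`, and the formula for `t` at `z` is carried over by `y ↦ d y`,
which respects `D_J`, the ideals and the Bruhat order (`isWGraphIdealBasis_indBasis`). The
involution is `h ⊗ m ↦ bar h ⊗ bar m`.

Uniqueness holds for any ideal: two associated modules can differ only in the polynomials of the
weak ascents. The involution is unitriangular with respect to length, and by induction on the length
the difference of two candidate sums is bar invariant with coefficients in `q ℤ[q]`, hence zero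
(`eq_zero_of_bar_eq`, `equiv_gen_smul`).

All this needs the basis `T_w` of an algebra given by generators and relations, for `W` and for
`W_K`. It is derived from the exchange condition, through Matsumoto's theorem and the regular
representation. The exchange condition passes to `W_K` directly, so no Coxeter presentation of `W_K`
is needed. -/

namespace WGraph

universe u v w

/-! ### The exchange condition in a Coxeter group. -/

section StrongExchange

variable {B W : Type*} [Group W] {M : CoxeterMatrix B} (cs : CoxeterSystem M W)

open Classical in
/-- The action of a simple reflection on pairs (element of `W`, parity). -/
noncomputable def parityAct (i : B) : Function.End (W × ZMod 2) :=
  fun p => (cs.simple i * p.1 * cs.simple i, p.2 + if p.1 = cs.simple i then 1 else 0)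

-- The `2 * k` letters of the power test for the elements `(s_j s_i)^n s_j` with `n < 2 * k`. For `k
-- = M i j` this list runs twice through the same elements, so the parity returns to its start: this
-- gives the Coxeter relations in `parityAct_isLiftable`.
open Classical in
theorem parityAct_mul_pow (i j : B) (k : ℕ) (p : W × ZMod 2) :
    ((parityAct cs i * parityAct cs j) ^ k) p =
      ((cs.simple i * cs.simple j) ^ k * p.1 * ((cs.simple i * cs.simple j) ^ k)⁻¹,
        p.2 + ∑ n ∈ Finset.range (2 * k),
          if p.1 = (cs.simple j * cs.simple i) ^ n * cs.simple j then 1 else 0) := by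
  have hinv : (cs.simple i * cs.simple j)⁻¹ = cs.simple j * cs.simple i := by simp
  induction k with
  | zero => simp; rfl
  | succ k ih =>
    rw [pow_succ']
    change parityAct cs i (parityAct cs j (((parityAct cs i * parityAct cs j) ^ k) p)) = _
    rw [ih]
    set x := cs.simple i * cs.simple j with hx
    set y := cs.simple j * cs.simple i with hy
    have hyx : y = x⁻¹ := hinv.symm
    -- The two additional letters contribute the summands `n = 2 * k` and `n = 2 * k + 1`.
    have h1 : (x ^ k * p.1 * (x ^ k)⁻¹ = cs.simple j) ↔ p.1 = y ^ (2 * k) * cs.simple j := by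
      have hs : y ^ k * cs.simple j = cs.simple j * x ^ k := by
        have : SemiconjBy (cs.simple j) x y := by
          simp [SemiconjBy, hx, hy, mul_assoc]
        exact ((this.pow_right k).eq).symm
      rw [mul_inv_eq_iff_eq_mul, ← eq_inv_mul_iff_mul_eq, two_mul, pow_add, mul_assoc, hs,
        hyx, inv_pow]
    have h2 : (cs.simple j * (x ^ k * p.1 * (x ^ k)⁻¹) * cs.simple j = cs.simple i) ↔
        p.1 = y ^ (2 * k + 1) * cs.simple j := by
      have hs : cs.simple j * cs.simple i * cs.simple j * x ^ k =
          y ^ (k + 1) * cs.simple j := by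
        have : SemiconjBy (cs.simple j) x y := by
          simp [SemiconjBy, hx, hy, mul_assoc]
        rw [pow_succ', mul_assoc, mul_assoc, (this.pow_right k).eq]
        simp only [hy, mul_assoc]
      have h3 : (cs.simple j * (x ^ k * p.1 * (x ^ k)⁻¹) * cs.simple j = cs.simple i) ↔
          x ^ k * p.1 * (x ^ k)⁻¹ = cs.simple j * cs.simple i * cs.simple j := by
        constructor
        · intro h; rw [← h]; simp [mul_assoc]
        · intro h; rw [h]; simp [mul_assoc]
      rw [h3, mul_inv_eq_iff_eq_mul, ← eq_inv_mul_iff_mul_eq, hs, ← inv_pow, ← hyx, ← mul_assoc,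
        ← pow_add]
      have : k + (k + 1) = 2 * k + 1 := by ring
      rw [this]
    simp only [parityAct, h1, h2]
    refine Prod.ext ?_ ?_
    · have h4 : x ^ (k + 1) = cs.simple i * cs.simple j * x ^ k := pow_succ' x k
      simp only [h4, mul_inv_rev, cs.inv_simple]
      simp only [mul_assoc]
    · have : 2 * (k + 1) = 2 * k + 1 + 1 := by ring
      simp only [this, Finset.sum_range_succ _ (2 * k + 1), Finset.sum_range_succ _ (2 * k),
        ← add_assoc]

theorem parityAct_isLiftable : M.IsLiftable (parityAct cs) := by
  classical
  intro i j
  funext p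
  rw [parityAct_mul_pow, cs.simple_mul_simple_pow, two_mul, Finset.sum_range_add]
  have : ∀ n, (cs.simple j * cs.simple i) ^ (M i j + n) = (cs.simple j * cs.simple i) ^ n := by
    intro n
    rw [pow_add, M.symmetric i j, cs.simple_mul_simple_pow, one_mul]
  simp only [this, CharTwo.add_self_eq_zero]
  simp
  rfl

-- Since the left side depends only on the product of the word, so does the parity of the
-- multiplicity of each element in the right inversion sequence, whether or not the word is reduced.
open Classical in
theorem lift_parityAct_wordProd (ω : List B) (p : W × ZMod 2) :
    cs.lift ⟨parityAct cs, parityAct_isLiftable cs⟩ (cs.wordProd ω) p =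
      (cs.wordProd ω * p.1 * (cs.wordProd ω)⁻¹, p.2 + (cs.rightInvSeq ω).count p.1) := by
  induction ω with
  | nil => simp; rfl
  | cons i ω ih =>
    rw [cs.wordProd_cons, map_mul, cs.lift_apply_simple]
    change parityAct cs i (cs.lift ⟨parityAct cs, parityAct_isLiftable cs⟩ (cs.wordProd ω) p) = _
    rw [ih]
    have h : (cs.wordProd ω * p.1 * (cs.wordProd ω)⁻¹ = cs.simple i) ↔
        (cs.wordProd ω)⁻¹ * cs.simple i * cs.wordProd ω = p.1 := by
      constructor
      · intro h; rw [← h]; group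
      · intro h; rw [← h]; group
    simp only [parityAct, CoxeterSystem.rightInvSeq, List.count_cons, beq_iff_eq, h]
    refine Prod.ext ?_ ?_
    · simp [mul_assoc]
    · simp [add_assoc]

/-- The exchange condition, for arbitrary (not necessarily reduced) words. -/
theorem exists_eraseIdx_of_isRightDescent (ω : List B) (i : B)
    (h : cs.IsRightDescent (cs.wordProd ω) i) :
    ∃ j < ω.length, cs.wordProd ω * cs.simple i = cs.wordProd (ω.eraseIdx j) := by
  classical
  -- The comparison is with a reduced word of the same element that ends in `i`. Its inversion
  -- sequence contains `s_i` exactly once, so by parity that of `ω` contains it too, and the letter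
  -- at that position is the one to delete.
  obtain ⟨ω', h1, h2⟩ := cs.exists_isReduced (cs.wordProd ω * cs.simple i)
  have h3 : cs.wordProd (ω'.concat i) = cs.wordProd ω := by
    rw [cs.wordProd_concat, ← h2]; simp
  have hred : cs.IsReduced (ω'.concat i) := by
    have := cs.isRightDescent_iff.1 h
    rw [CoxeterSystem.IsReduced, h3, ← this, h2, h1.eq]
    simp
  have e1 := lift_parityAct_wordProd cs ω (cs.simple i, 0)
  rw [← h3, lift_parityAct_wordProd] at e1
  have e2 := congrArg Prod.snd e1
  simp only [zero_add] at e2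
  rw [List.count_eq_one_of_mem hred.nodup_rightInvSeq
    (by rw [cs.rightInvSeq_concat]; simp)] at e2
  have hmem : cs.simple i ∈ cs.rightInvSeq ω := by
    by_contra hn
    rw [List.count_eq_zero_of_not_mem hn] at e2
    simp at e2
  obtain ⟨j, hj, hj'⟩ := List.mem_iff_getElem.1 hmem
  refine ⟨j, by simpa using hj, ?_⟩
  rw [← cs.wordProd_mul_getD_rightInvSeq, List.getD_eq_getElem _ 1 hj, hj']

end StrongExchange

/-! ### Groups generated by involutions with the exchange condition. -/

section ExchangeSystem

variable {G : Type u} [Group G] {S : Set G}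

/-- The product of a word in the elements of `S`. -/
def wprod (ω : List S) : G := (ω.map Subtype.val).prod

@[simp] theorem wprod_nil : wprod ([] : List S) = 1 := rfl

@[simp] theorem wprod_cons (s : S) (ω : List S) : wprod (s :: ω) = s * wprod ω := by
  simp [wprod]

@[simp] theorem wprod_append (ω ω' : List S) : wprod (ω ++ ω') = wprod ω * wprod ω' := by
  simp [wprod]

variable (S) in
/-- A generating set of involutions which satisfies the exchange condition. -/
structure ExchangeSystem : Prop where
  mul_self : ∀ s : S, (s : G) * s = 1
  closure_eq_top : Subgroup.closure S = ⊤
  len_mul_ne : ∀ (w : G) (s : S), len S (w * s) ≠ len S w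
  exchange : ∀ (ω : List S) (s : S), len S (wprod ω * s) < len S (wprod ω) →
    ∃ j < ω.length, wprod ω * s = wprod (ω.eraseIdx j)

theorem len_eq_sInf (w : G) :
    len S w = sInf {n | ∃ ω : List S, ω.length = n ∧ wprod ω = w} := by
  unfold len
  congr 1
  ext n
  constructor
  · rintro ⟨ω, h1, h2, h3⟩
    refine ⟨ω.attachWith (· ∈ S) h1, by simpa using h2, ?_⟩
    rw [wprod, List.attachWith_map_subtype_val, h3]
  · rintro ⟨ω, h1, h2⟩
    exact ⟨ω.map Subtype.val, by simp +contextual, by simpa using h1, h2⟩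

theorem len_wprod_le (ω : List S) : len S (wprod ω) ≤ ω.length := by
  rw [len_eq_sInf]
  exact Nat.sInf_le ⟨ω, rfl, rfl⟩

@[simp] theorem len_one : len S (1 : G) = 0 :=
  Nat.le_zero.1 (len_wprod_le (S := S) [])

/-- A word is reduced if it is a shortest word for its product. -/
def IsRed (ω : List S) : Prop := len S (wprod ω) = ω.length

namespace ExchangeSystem

theorem inv_eq (h : ExchangeSystem S) (s : S) : (s : G)⁻¹ = s :=
  inv_eq_of_mul_eq_one_left (h.mul_self s)

theorem mul_cancel_left (h : ExchangeSystem S) (s : S) (w : G) : (s : G) * (s * w) = w := by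
  rw [← mul_assoc, h.mul_self, one_mul]

theorem mul_cancel_right (h : ExchangeSystem S) (s : S) (w : G) : w * s * s = w := by
  rw [mul_assoc, h.mul_self, mul_one]

theorem wprod_reverse (h : ExchangeSystem S) (ω : List S) :
    wprod ω.reverse = (wprod ω)⁻¹ := by
  induction ω with
  | nil => simp
  | cons s ω ih => simp [ih, h.inv_eq]

theorem wprod_surjective (h : ExchangeSystem S) (w : G) : ∃ ω : List S, wprod ω = w := by
  have hw : w ∈ Subgroup.closure S := h.closure_eq_top ▸ Subgroup.mem_top w
  induction hw using Subgroup.closure_induction with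
  | mem x hx => exact ⟨[⟨x, hx⟩], by simp⟩
  | one => exact ⟨[], rfl⟩
  | mul x y _ _ hx hy =>
    obtain ⟨ω, rfl⟩ := hx
    obtain ⟨ω', rfl⟩ := hy
    exact ⟨ω ++ ω', by simp⟩
  | inv x _ hx =>
    obtain ⟨ω, rfl⟩ := hx
    exact ⟨ω.reverse, h.wprod_reverse ω⟩

theorem exists_isRed (h : ExchangeSystem S) (w : G) : ∃ ω : List S, IsRed ω ∧ wprod ω = w := by
  have hne : {n | ∃ ω : List S, ω.length = n ∧ wprod ω = w}.Nonempty := by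
    obtain ⟨ω, hω⟩ := h.wprod_surjective w
    exact ⟨_, ω, rfl, hω⟩
  obtain ⟨ω, h1, h2⟩ := Nat.sInf_mem hne
  refine ⟨ω, ?_, h2⟩
  rw [IsRed, h1, h2, len_eq_sInf]

theorem eq_one_of_len_eq_zero (h : ExchangeSystem S) {w : G} (hw : len S w = 0) : w = 1 := by
  obtain ⟨ω, h1, rfl⟩ := h.exists_isRed w
  rw [h1, List.length_eq_zero_iff] at hw
  simp [hw]

theorem len_mul_le (h : ExchangeSystem S) (u w : G) : len S (u * w) ≤ len S u + len S w := by
  obtain ⟨ω, h1, rfl⟩ := h.exists_isRed u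
  obtain ⟨ω', h2, rfl⟩ := h.exists_isRed w
  rw [h1, h2, ← wprod_append, ← List.length_append]
  exact len_wprod_le _

@[simp] theorem len_inv (h : ExchangeSystem S) (w : G) : len S w⁻¹ = len S w := by
  have key : ∀ w : G, len S w⁻¹ ≤ len S w := by
    intro w
    obtain ⟨ω, h1, rfl⟩ := h.exists_isRed w
    rw [h1, ← h.wprod_reverse, ← List.length_reverse]
    exact len_wprod_le _
  exact le_antisymm (key w) (by simpa using key w⁻¹)

theorem len_simple (h : ExchangeSystem S) (s : S) : len S (s : G) = 1 := by
  have h1 := len_wprod_le [s]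
  have h2 := h.len_mul_ne 1 s
  simp at h1 h2
  omega

theorem len_mul_simple (h : ExchangeSystem S) (w : G) (s : S) :
    len S (w * s) = len S w + 1 ∨ len S w = len S (w * s) + 1 := by
  have h1 := h.len_mul_le w s
  have h2 := h.len_mul_le (w * s) s
  rw [h.mul_cancel_right] at h2
  rw [h.len_simple] at h1 h2
  have h3 := h.len_mul_ne w s
  omega

theorem len_inv_mul_simple (h : ExchangeSystem S) (w : G) (s : S) :
    len S (w⁻¹ * s) = len S (s * w) := by
  rw [← h.len_inv, mul_inv_rev, inv_inv, h.inv_eq]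

theorem len_simple_mul (h : ExchangeSystem S) (w : G) (s : S) :
    len S (s * w) = len S w + 1 ∨ len S w = len S (s * w) + 1 := by
  have := h.len_mul_simple w⁻¹ s
  rwa [h.len_inv, h.len_inv_mul_simple] at this

theorem exchange_left (h : ExchangeSystem S) (ω : List S) (s : S)
    (hs : len S (s * wprod ω) < len S (wprod ω)) :
    ∃ j < ω.length, s * wprod ω = wprod (ω.eraseIdx j) := by
  have h1 := h.exchange ω.reverse s
  rw [h.wprod_reverse, h.len_inv, h.len_inv_mul_simple] at h1
  obtain ⟨j, hj, hj'⟩ := h1 hs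
  rw [List.length_reverse] at hj
  -- Position `j` of the reversed word is position `ω.length - 1 - j` of the word.
  refine ⟨ω.length - 1 - j, by omega, ?_⟩
  have h2 := congrArg (·⁻¹) hj'
  simp only [mul_inv_rev, inv_inv, h.inv_eq] at h2
  rw [h2, ← h.wprod_reverse, List.eraseIdx_eq_take_drop_succ, List.eraseIdx_eq_take_drop_succ,
    List.reverse_append, List.take_reverse, List.drop_reverse, List.reverse_reverse,
    List.reverse_reverse, show ω.length - 1 - j + 1 = ω.length - j by omega,
    show ω.length - (j + 1) = ω.length - 1 - j by omega]

/-- The folding condition. -/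
theorem mul_eq_mul_of_len (h : ExchangeSystem S) {w : G} {s t : S}
    (hs : len S w < len S (s * w)) (ht : len S w < len S (w * t))
    (hst : len S (s * w * t) ≠ len S w + 2) : (s : G) * w = w * t := by
  obtain ⟨ω, h1, rfl⟩ := h.exists_isRed w
  have h2 := h.len_simple_mul (wprod ω) s
  have h3 := h.len_mul_simple (wprod ω) t
  have h4 := h.len_mul_simple (s * wprod ω) t
  -- The lengths make `s` a left descent of `w t`. Deleting a letter of `ω` would make `s w` shorter
  -- than `w`, so the deleted letter is the final `t`, and `s w t = w`.
  have h5 := h.exchange_left (ω ++ [t]) s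
  simp only [wprod_append, wprod_cons, wprod_nil, mul_one, ← mul_assoc] at h5
  obtain ⟨j, hj, hj'⟩ := h5 (by omega)
  rw [List.length_append, List.length_singleton] at hj
  by_cases hjl : j < ω.length
  · rw [List.eraseIdx_append_of_lt_length hjl] at hj'
    simp only [wprod_append, wprod_cons, wprod_nil, mul_one, mul_left_inj] at hj'
    have h6 := len_wprod_le (ω.eraseIdx j)
    rw [← hj', List.length_eraseIdx_of_lt hjl, ← h1] at h6
    omega
  · obtain rfl : j = ω.length := by omega
    rw [List.eraseIdx_append_of_length_le le_rfl] at hj'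
    simp only [Nat.sub_self, List.eraseIdx_zero, List.tail_cons, List.append_nil] at hj'
    rw [← h.mul_cancel_right t (s * wprod ω), hj']

end ExchangeSystem
end ExchangeSystem
-- Alternating words and Matsumoto's theorem.
section AltList

/-- The word `s t s ⋯` with `n` letters. -/
def altList {α : Type*} (s t : α) : ℕ → List α
  | 0 => []
  | n + 1 => s :: altList t s n

@[simp] theorem length_altList {α : Type*} (s t : α) (n : ℕ) : (altList s t n).length = n := by
  induction n generalizing s t with
  | zero => rfl
  | succ n ih => simp [altList, ih]

theorem prod_map_altList {R : Type*} [Monoid R] {α : Type*} (f : α → R) (s t : α) (n : ℕ) :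
    ((altList s t n).map f).prod = altProd (f s) (f t) n := by
  induction n generalizing s t with
  | zero => rfl
  | succ n ih => simp [altList, altProd, ih]

theorem altList_add {α : Type*} (s t : α) (m n : ℕ) : ∃ ω, altList s t (m + n) = altList s t m ++ ω := by
  induction m generalizing s t with
  | zero => exact ⟨_, by rw [Nat.zero_add]; rfl⟩
  | succ m ih =>
    obtain ⟨ω, hω⟩ := ih t s
    exact ⟨ω, by rw [Nat.add_right_comm, altList, hω]; rfl⟩

theorem altList_succ_eq_append {α : Type*} (s t : α) (n : ℕ) : ∃ u, altList s t (n + 1) = altList s t n ++ [u] := by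
  obtain ⟨ω, hω⟩ := altList_add s t n 1
  have h1 := congrArg List.length hω
  simp only [length_altList, List.length_append, Nat.add_left_cancel_iff] at h1
  obtain ⟨u, rfl⟩ := List.length_eq_one_iff.1 h1.symm
  exact ⟨u, hω⟩

end AltList

section Matsumoto

variable {G : Type u} [Group G] {S : Set G}

theorem IsRed.of_append_right {ω ω' : List S} (h : ExchangeSystem S) (hr : IsRed (ω ++ ω')) :
    IsRed ω' := by
  have h1 := h.len_mul_le (wprod ω) (wprod ω')
  rw [← wprod_append, hr, List.length_append] at h1
  have h2 := len_wprod_le ω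
  have h3 := len_wprod_le ω'
  unfold IsRed
  omega

theorem IsRed.of_append_left {ω ω' : List S} (h : ExchangeSystem S) (hr : IsRed (ω ++ ω')) :
    IsRed ω := by
  have h1 := h.len_mul_le (wprod ω) (wprod ω')
  rw [← wprod_append, hr, List.length_append] at h1
  have h2 := len_wprod_le ω
  have h3 := len_wprod_le ω'
  unfold IsRed
  omega

theorem IsRed.tail {s : S} {ω : List S} (h : ExchangeSystem S) (hr : IsRed (s :: ω)) : IsRed ω :=
  IsRed.of_append_right (ω := [s]) h hr

theorem wprod_altList (s t : S) (n : ℕ) : wprod (altList s t n) = altProd (s : G) t n :=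
  prod_map_altList _ s t n

/-- For involutions, the two alternating products of `n` factors thus agree exactly when `(x y)^n =
1`. -/
theorem altProd_eq_pow_mul {x y : G} (hx : x * x = 1) (hy : y * y = 1) (n : ℕ) :
    altProd x y n = (x * y) ^ n * altProd y x n := by
  induction n generalizing x y with
  | zero => simp [altProd]
  | succ n ih =>
    have h1 : SemiconjBy x (y * x) (x * y) := by simp [SemiconjBy, mul_assoc]
    rw [altProd, altProd, ih hy hx, ← mul_assoc, (h1.pow_right n).eq, pow_succ]
    simp only [mul_assoc]
    rw [← mul_assoc y y, hy, one_mul]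

theorem pow_eq_one_of_altProd_eq {x y : G} (hx : x * x = 1) (hy : y * y = 1) {n : ℕ}
    (h : altProd x y n = altProd y x n) : (x * y) ^ n = 1 := by
  rw [altProd_eq_pow_mul hx hy] at h
  exact mul_eq_right.1 h

theorem altProd_comm_orderOf {x y : G} (hx : x * x = 1) (hy : y * y = 1) :
    altProd x y (orderOf (x * y)) = altProd y x (orderOf (x * y)) := by
  rw [altProd_eq_pow_mul hx hy, pow_orderOf_eq_one, one_mul]

theorem orderOf_mul_comm_of_mul_self {x y : G} (hx : x * x = 1) (hy : y * y = 1) :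
    orderOf (y * x) = orderOf (x * y) := by
  rw [← orderOf_inv (x * y), mul_inv_rev, inv_eq_of_mul_eq_one_left hx,
    inv_eq_of_mul_eq_one_left hy]

/-- After the first letter come `orderOf (s * t)` alternating letters, which can be rewritten to
begin with `s`; the two `s` cancel. Infinite order has the value 0 and is excluded by `h0`. -/
theorem not_isRed_altList (h : ExchangeSystem S) (s t : S)
    (h0 : 0 < orderOf ((s : G) * t)) {n : ℕ} (hn : orderOf ((s : G) * t) < n) :
    ¬ IsRed (altList s t n) := by
  intro hr
  obtain ⟨m, hm⟩ := Nat.exists_eq_succ_of_ne_zero h0.ne'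
  obtain ⟨ω, hω⟩ := altList_add s t (orderOf ((s : G) * t) + 1) (n - (orderOf ((s : G) * t) + 1))
  rw [Nat.add_sub_cancel' hn] at hω
  rw [hω] at hr
  have h1 := hr.of_append_left h
  rw [IsRed, altList, wprod_cons, wprod_altList,
    ← altProd_comm_orderOf (h.mul_self s) (h.mul_self t), hm, altProd,
    h.mul_cancel_left, ← wprod_altList] at h1
  have h2 := len_wprod_le (altList t s m)
  rw [length_altList] at h2
  rw [List.length_cons, length_altList] at h1
  omega

/-- An alternating word with at most `orderOf (s * t)` letters is reduced. -/
theorem isRed_altList (h : ExchangeSystem S) (s t : S) {n : ℕ} (hn : n ≤ orderOf ((s : G) * t)) :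
    IsRed (altList s t n) := by
  induction n generalizing s t with
  | zero => simp [IsRed, altList]
  | succ n ih =>
    have ho := orderOf_mul_comm_of_mul_self (h.mul_self s) (h.mul_self t)
    have h1 := ih t s (by omega)
    rcases Nat.eq_zero_or_pos n with rfl | hpos
    · simp [IsRed, altList, h.len_simple]
    obtain ⟨k, rfl⟩ := Nat.exists_eq_succ_of_ne_zero hpos.ne'
    obtain ⟨u, hu⟩ := altList_succ_eq_append t s k
    have h2 := ih s t (by omega)
    by_contra hcon
    rw [hu] at h1
    have h4 := h1.of_append_left h
    simp only [IsRed, wprod_append, wprod_cons, wprod_nil, mul_one, altList, length_altList,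
      List.length_append, List.length_cons, List.length_nil] at h1 h2 h4
    have h5 : wprod (altList s t (k + 1 + 1)) = s * wprod (altList t s k) * u := by
      rw [altList, hu]
      simp [mul_assoc]
    rw [IsRed, length_altList, h5, mul_assoc] at hcon
    have h6 := h.len_simple_mul (wprod (altList t s k) * u) s
    rw [← mul_assoc] at h6 hcon
    -- If the word were not reduced, the folding condition for its inner `k` letters would identify
    -- the two alternating words of `k + 1` letters. Then `(s t)^(k + 1) = 1`, although `k + 1` is
    -- below the order.
    have h7 := h.mul_eq_mul_of_len (w := wprod (altList t s k)) (s := s) (t := u) (by omega)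
      (by omega) (by omega)
    have h8 : wprod (altList s t (k + 1)) = wprod (altList t s (k + 1)) := by
      rw [hu, altList, wprod_cons, h7]
      simp
    rw [wprod_altList, wprod_altList] at h8
    have h9 := orderOf_le_of_pow_eq_one k.succ_pos
      (pow_eq_one_of_altProd_eq (h.mul_self s) (h.mul_self t) h8)
    omega

/-- Equality of the two words forces `(s t)^n = 1`, and reducedness forces `n` to be at most the
order. So a positive `n` is the order itself, and `hf` applies. -/
theorem altProd_eq_of_isRed {R : Type*} [Monoid R] (h : ExchangeSystem S) (f : S → R) (s t : S)
    (hf : altProd (f s) (f t) (orderOf ((s : G) * t)) =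
      altProd (f t) (f s) (orderOf ((s : G) * t))) {n : ℕ} (hr : IsRed (altList s t n))
    (he : wprod (altList s t n) = wprod (altList t s n)) :
    altProd (f s) (f t) n = altProd (f t) (f s) n := by
  rcases Nat.eq_zero_or_pos n with rfl | hpos
  · rfl
  rw [wprod_altList, wprod_altList] at he
  have h1 := pow_eq_one_of_altProd_eq (h.mul_self s) (h.mul_self t) he
  have h2 := orderOf_le_of_pow_eq_one hpos h1
  have h3 := orderOf_pos_iff.2 (isOfFinOrder_iff_pow_eq_one.2 ⟨n, hpos, h1⟩)
  have h4 : n ≤ orderOf ((s : G) * t) := by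
    by_contra h4
    exact not_isRed_altList h s t h3 (not_le.1 h4) hr
  rwa [le_antisymm h4 h2]

/-- Matsumoto's theorem: a map into a monoid which satisfies the braid relations takes the same
value on all reduced words of an element. -/
theorem prod_map_eq_of_isRed {R : Type*} [Monoid R] (h : ExchangeSystem S) (f : S → R)
    (hf : ∀ s t : S, altProd (f s) (f t) (orderOf ((s : G) * t)) =
      altProd (f t) (f s) (orderOf ((s : G) * t))) {ω ω' : List S} (hω : IsRed ω)
    (hω' : IsRed ω') (he : wprod ω = wprod ω') : (ω.map f).prod = (ω'.map f).prod := by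
  have hlen : ω.length = ω'.length := by rw [← hω, ← hω', he]
  obtain ⟨n, hn⟩ : ∃ n, ω.length = n := ⟨_, rfl⟩
  induction n generalizing ω ω' with
  | zero =>
    rw [hn, eq_comm, List.length_eq_zero_iff] at hlen
    rw [List.length_eq_zero_iff] at hn
    rw [hn, hlen]
  | succ n ih =>
    have same_head : ∀ (s : S) (α β : List S), IsRed (s :: α) → IsRed (s :: β) →
        wprod (s :: α) = wprod (s :: β) → (s :: α).length = n + 1 →
        ((s :: α).map f).prod = ((s :: β).map f).prod := by
      intro s α β h1 h2 h3 h4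
      have h5 : α.length = β.length := by
        have : (s :: α).length = (s :: β).length := by rw [← h1, ← h2, h3]
        simpa using this
      rw [wprod_cons, wprod_cons, mul_right_inj] at h3
      simp only [List.map_cons, List.prod_cons]
      rw [ih (h1.tail h) (h2.tail h) h3 h5 (by simpa using h4)]
    have same_last : ∀ (u : S) (α β : List S), IsRed (α ++ [u]) → IsRed (β ++ [u]) →
        wprod (α ++ [u]) = wprod (β ++ [u]) → (α ++ [u]).length = n + 1 →
        ((α ++ [u]).map f).prod = ((β ++ [u]).map f).prod := by
      intro u α β h1 h2 h3 h4
      have h5 : α.length = β.length := by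
        have : (α ++ [u]).length = (β ++ [u]).length := by rw [← h1, ← h2, h3]
        simpa using this
      rw [wprod_append, wprod_append, mul_left_inj] at h3
      simp only [List.map_append, List.prod_append]
      rw [ih (h1.of_append_left h) (h2.of_append_left h) h3 h5 (by simpa using h4)]
    -- Exchange puts `t` in front of `α ++ [u]` and deletes a letter. The new word shares its first
    -- letter with `t :: β` and therefore its value. If the deleted letter were not the final `u`,
    -- it would also share the last letter and the value of `α ++ [u]`, against the assumption.
    have step : ∀ (t u : S) (α β : List S), IsRed (α ++ [u]) → IsRed (t :: β) →
        wprod (α ++ [u]) = wprod (t :: β) → (α ++ [u]).length = n + 1 →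
        ((α ++ [u]).map f).prod ≠ ((t :: β).map f).prod →
        IsRed (t :: α) ∧ wprod (t :: α) = wprod (α ++ [u]) ∧
          ((t :: α).map f).prod ≠ ((α ++ [u]).map f).prod := by
      intro t u α β h1 h2 h3 h4 h5
      have h6 : len S (t * wprod (α ++ [u])) < len S (wprod (α ++ [u])) := by
        rw [h3, h2, wprod_cons, h.mul_cancel_left, h2.tail h]
        simp
      obtain ⟨j, hj, hj'⟩ := h.exchange_left _ t h6
      have h7 : wprod (t :: (α ++ [u]).eraseIdx j) = wprod (α ++ [u]) := by
        rw [wprod_cons, ← hj', h.mul_cancel_left]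
      have h8 : IsRed (t :: (α ++ [u]).eraseIdx j) := by
        rw [IsRed, h7, h1, List.length_cons, List.length_eraseIdx_of_lt hj]
        omega
      have h9 : ((t :: (α ++ [u]).eraseIdx j).map f).prod = ((t :: β).map f).prod := by
        refine same_head _ _ _ h8 h2 (h7.trans h3) ?_
        rw [← h8, h7, h1, h4]
      by_cases hjl : j < α.length
      · exfalso
        rw [List.eraseIdx_append_of_lt_length hjl, ← List.cons_append] at h7 h8 h9
        exact h5 (h9 ▸ same_last _ _ _ h1 h8 h7.symm h4)
      · rw [List.length_append, List.length_singleton] at hj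
        obtain rfl : j = α.length := by omega
        rw [List.eraseIdx_append_of_length_le le_rfl] at h7 h8 h9
        simp only [Nat.sub_self, List.eraseIdx_zero, List.tail_cons, List.append_nil] at h7 h8 h9
        exact ⟨h8, h7, fun e => h5 (e ▸ h9)⟩
    by_contra hne
    -- Each use of `step` turns a counterexample into another whose alternating beginning is one
    -- letter longer. In the end two alternating words of `n + 1` letters remain, for which the
    -- braid relation suffices.
    have main : ∀ k ≤ n, ∃ (s t : S) (α β : List S), IsRed (altList s t (k + 1) ++ α) ∧
        IsRed (t :: β) ∧ wprod (altList s t (k + 1) ++ α) = wprod (t :: β) ∧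
        (altList s t (k + 1) ++ α).length = n + 1 ∧
        ((altList s t (k + 1) ++ α).map f).prod ≠ ((t :: β).map f).prod := by
      intro k hk
      induction k with
      | zero =>
        obtain ⟨s, α, rfl⟩ := List.exists_cons_of_length_eq_add_one hn
        obtain ⟨t, β, rfl⟩ := List.exists_cons_of_length_eq_add_one (hlen ▸ hn)
        exact ⟨s, t, α, β, hω, hω', he, hn, hne⟩
      | succ k ihk =>
        obtain ⟨s, t, α, β, h1, h2, h3, h4, h5⟩ := ihk (by omega)
        rcases List.eq_nil_or_concat α with rfl | ⟨α', u, rfl⟩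
        · simp at h4; omega
        rw [List.concat_eq_append, ← List.append_assoc] at h1 h3 h4 h5
        obtain ⟨h6, h7, h8⟩ := step t u _ β h1 h2 h3 h4 h5
        refine ⟨t, s, α', altList t s k ++ α' ++ [u], h6, h1, h7, ?_, h8⟩
        change (t :: (altList s t (k + 1) ++ α')).length = n + 1
        rw [← h6, h7, h1, h4]
    obtain ⟨s, t, α, β, h1, h2, h3, h4, h5⟩ := main n le_rfl
    obtain rfl : α = [] := by
      rw [List.length_append, length_altList] at h4
      exact List.length_eq_zero_iff.1 (by omega)
    rw [List.append_nil] at h1 h3 h4 h5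
    obtain ⟨u, hu⟩ := altList_succ_eq_append s t n
    have h6 := step t u (altList s t n) β
    rw [← hu] at h6
    obtain ⟨h7, h8, h9⟩ := h6 h1 h2 h3 h4 h5
    change wprod (altList t s (n + 1)) = _ at h8
    apply h9
    change ((altList t s (n + 1)).map f).prod = _
    rw [prod_map_altList, prod_map_altList]
    exact (altProd_eq_of_isRed h f s t (hf s t) h1 h8.symm).symm

end Matsumoto
-- The standard basis of the Hecke algebra.
section HeckeBasis

variable {G : Type u} [Group G] {S : Set G}

/-- Left multiplication by `T_s` on the free module with basis `G`. -/
noncomputable def leftOp (S : Set G) (s : S) : Module.End ℤ[T;T⁻¹] (G →₀ ℤ[T;T⁻¹]) :=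
  Finsupp.linearCombination _ fun w => Finsupp.single ((s : G) * w) 1 +
    if len S w < len S (s * w) then 0 else (q - qinv) • Finsupp.single w 1

/-- Right multiplication by `T_s` on the free module with basis `G`. -/
noncomputable def rightOp (S : Set G) (s : S) : Module.End ℤ[T;T⁻¹] (G →₀ ℤ[T;T⁻¹]) :=
  Finsupp.linearCombination _ fun w => Finsupp.single (w * (s : G)) 1 +
    if len S w < len S (w * s) then 0 else (q - qinv) • Finsupp.single w 1

theorem leftOp_single (s : S) (w : G) : leftOp S s (Finsupp.single w 1) =
    Finsupp.single ((s : G) * w) 1 +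
      if len S w < len S (s * w) then 0 else (q - qinv) • Finsupp.single w 1 := by
  simp [leftOp]

theorem rightOp_single (s : S) (w : G) : rightOp S s (Finsupp.single w 1) =
    Finsupp.single (w * (s : G)) 1 +
      if len S w < len S (w * s) then 0 else (q - qinv) • Finsupp.single w 1 := by
  simp [rightOp]

theorem end_ext {G : Type*} {P Q : Module.End ℤ[T;T⁻¹] (G →₀ ℤ[T;T⁻¹])}
    (hPQ : ∀ w : G, P (Finsupp.single w 1) = Q (Finsupp.single w 1)) : P = Q :=
  Finsupp.lhom_ext' fun w => LinearMap.ext_ring (hPQ w)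

namespace ExchangeSystem

/-- If `w t` is longer than `w`, a failure would let the folding condition force `s w = w t`. If it
is shorter, the lengths alone decide. -/
theorem lt_len_mul_mul_of_lt (h : ExchangeSystem S) {w : G} {s t : S}
    (hne : (s : G) * w ≠ w * t) (hs : len S w < len S (s * w)) :
    len S (w * t) < len S (s * (w * t)) := by
  rw [← mul_assoc]
  have h1 := h.len_mul_simple w t
  have h2 := h.len_mul_simple (s * w) t
  have h3 := h.len_simple_mul w s
  have h4 := h.len_simple_mul (w * t) s
  rw [← mul_assoc] at h4
  by_contra hcon
  rcases h1 with h1 | h1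
  · exact hne (h.mul_eq_mul_of_len hs (by omega) (by omega))
  · omega

theorem lt_len_mul_mul_iff (h : ExchangeSystem S) {w : G} {s t : S}
    (hne : (s : G) * w ≠ w * t) :
    len S (w * t) < len S (s * (w * t)) ↔ len S w < len S (s * w) := by
  refine ⟨fun h1 => ?_, h.lt_len_mul_mul_of_lt hne⟩
  have := h.lt_len_mul_mul_of_lt (w := w * t) (s := s) (t := t)
    (fun e => hne (by
      rw [h.mul_cancel_right] at e
      rw [← h.mul_cancel_left s (w * t), e])) h1
  rwa [h.mul_cancel_right] at this

theorem lt_len_mul_mul_iff' (h : ExchangeSystem S) {w : G} {s t : S}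
    (hne : (s : G) * w ≠ w * t) :
    len S (s * w) < len S (s * (w * t)) ↔ len S w < len S (w * t) := by
  have h1 := h.lt_len_mul_mul_iff (w := w⁻¹) (s := t) (t := s) (by
    intro e
    apply hne
    have := congrArg (·⁻¹) e
    simp only [mul_inv_rev, inv_inv, h.inv_eq] at this
    exact this.symm)
  rw [h.len_inv_mul_simple, h.len_inv, ← h.len_inv (t * w⁻¹), ← h.len_inv (t * (w⁻¹ * s))] at h1
  simpa [h.inv_eq, mul_assoc] using h1

/-- If `s w ≠ w t`, left and right ascents do not influence each other and the terms match one by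
one. If `s w = w t`, both operators act in the same way on the vectors of `w` and `s w`. -/
theorem leftOp_mul_rightOp (h : ExchangeSystem S) (s t : S) :
    leftOp S s * rightOp S t = rightOp S t * leftOp S s := by
  refine end_ext fun w => ?_
  simp only [Module.End.mul_apply, leftOp_single, rightOp_single, map_add]
  by_cases hne : (s : G) * w = w * t
  · have e1 : (s : G) * (w * t) = w := by rw [← hne, h.mul_cancel_left]
    have e2 : (s : G) * w * t = w := by rw [hne, h.mul_cancel_right]
    have h1 := h.len_simple_mul w s
    by_cases hs : len S w < len S (s * w)
    · simp only [← hne, h.mul_cancel_left, e2, if_pos hs, if_neg hs.not_gt, map_zero]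
    · have hs' : len S (s * w) < len S w := by omega
      simp only [← hne, h.mul_cancel_left, e2, if_neg hs, if_pos hs', map_smul, leftOp_single,
        rightOp_single]
  · by_cases hs : len S w < len S (s * w) <;> by_cases ht : len S w < len S (w * t) <;>
      simp only [hs, ht, if_true, if_false, map_zero, map_smul, leftOp_single, rightOp_single,
        h.lt_len_mul_mul_iff hne, h.lt_len_mul_mul_iff' hne, mul_assoc, smul_add, add_zero]
    exact add_add_add_comm _ _ _ _

theorem leftOp_mul_self (h : ExchangeSystem S) (s : S) :
    leftOp S s * leftOp S s = 1 + (q - qinv) • leftOp S s := by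
  refine end_ext fun w => ?_
  have h1 := h.len_simple_mul w s
  simp only [Module.End.mul_apply, leftOp_single, map_add, LinearMap.add_apply,
    Module.End.one_apply, LinearMap.smul_apply, h.mul_cancel_left]
  by_cases hs : len S w < len S (s * w)
  · have h2 : ¬ len S (s * w) < len S w := by omega
    simp [hs, h2]
  · have h2 : len S (s * w) < len S w := by omega
    simp only [if_neg hs, if_pos h2, map_smul, leftOp_single, add_zero]

theorem altProd_leftOp_single_one (h : ExchangeSystem S) (s t : S) {n : ℕ}
    (hn : n ≤ orderOf ((s : G) * t)) :
    altProd (leftOp S s) (leftOp S t) n (Finsupp.single 1 1) =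
      Finsupp.single (altProd (s : G) t n) 1 := by
  induction n generalizing s t with
  | zero => simp [altProd]
  | succ n ih =>
    have ho := orderOf_mul_comm_of_mul_self (h.mul_self s) (h.mul_self t)
    have h1 := isRed_altList h s t hn
    have h2 := h1
    rw [altList] at h2
    replace h2 := h2.tail h
    rw [IsRed, wprod_altList, length_altList] at h1 h2
    rw [altProd, Module.End.mul_apply, ih t s (by omega), leftOp_single, if_pos, add_zero, altProd]
    rw [altProd] at h1
    omega

theorem commute_altProd {R : Type*} [Monoid R] {x y z : R} (hx : Commute x z) (hy : Commute y z)
    (n : ℕ) : Commute (altProd x y n) z := by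
  induction n generalizing x y with
  | zero => exact Commute.one_left z
  | succ n ih => exact hx.mul_left (ih hy hx)

/-- The right operators lead from the vector of 1 to every basis vector along a reduced word. So the
braid relation for the left operators has to be checked at 1 only. -/
theorem eq_of_commute_rightOp (h : ExchangeSystem S)
    {P Q : Module.End ℤ[T;T⁻¹] (G →₀ ℤ[T;T⁻¹])} (hP : ∀ t : S, Commute P (rightOp S t))
    (hQ : ∀ t : S, Commute Q (rightOp S t))
    (h1 : P (Finsupp.single 1 1) = Q (Finsupp.single 1 1)) : P = Q := by
  refine end_ext fun w => ?_
  obtain ⟨ω, hω, rfl⟩ := h.exists_isRed w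
  induction ω using List.reverseRecOn with
  | nil => exact h1
  | append_singleton ω t ih =>
    have h2 := hω.of_append_left h
    have h3 : Finsupp.single (wprod (ω ++ [t])) (1 : ℤ[T;T⁻¹]) =
        rightOp S t (Finsupp.single (wprod ω) 1) := by
      rw [rightOp_single, if_pos, add_zero]
      · simp
      · rw [IsRed] at hω h2
        rw [h2]
        simp at hω
        rw [hω]
        omega
    rw [h3, ← Module.End.mul_apply, hP t, ← Module.End.mul_apply, hQ t, Module.End.mul_apply,
      Module.End.mul_apply, ih h2]

theorem leftOp_braid (h : ExchangeSystem S) (s t : S) :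
    altProd (leftOp S s) (leftOp S t) (orderOf ((s : G) * (t : G))) =
      altProd (leftOp S t) (leftOp S s) (orderOf ((s : G) * (t : G))) := by
  have ho := orderOf_mul_comm_of_mul_self (h.mul_self s) (h.mul_self t)
  refine h.eq_of_commute_rightOp
    (fun u => commute_altProd (h.leftOp_mul_rightOp s u) (h.leftOp_mul_rightOp t u) _)
    (fun u => commute_altProd (h.leftOp_mul_rightOp t u) (h.leftOp_mul_rightOp s u) _) ?_
  rw [h.altProd_leftOp_single_one s t le_rfl, h.altProd_leftOp_single_one t s ho.ge,
    altProd_comm_orderOf (h.mul_self s) (h.mul_self t)]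

theorem lift_leftOp_rel (h : ExchangeSystem S) ⦃x y : FreeAlgebra ℤ[T;T⁻¹] S⦄
    (hr : HeckeRel S x y) :
    FreeAlgebra.lift ℤ[T;T⁻¹] (leftOp S) x = FreeAlgebra.lift ℤ[T;T⁻¹] (leftOp S) y := by
  cases hr with
  | quadratic s =>
    simp only [map_mul, map_add, map_one, map_smul, FreeAlgebra.lift_ι_apply]
    exact h.leftOp_mul_self s
  | braid s t =>
    rw [map_altProd, map_altProd]
    simp only [FreeAlgebra.lift_ι_apply]
    exact h.leftOp_braid s t

/-- The left regular representation of the Hecke algebra. -/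
noncomputable def regularRep (h : ExchangeSystem S) :
    Hecke S →ₐ[ℤ[T;T⁻¹]] Module.End ℤ[T;T⁻¹] (G →₀ ℤ[T;T⁻¹]) :=
  RingQuot.liftAlgHom ℤ[T;T⁻¹] ⟨FreeAlgebra.lift ℤ[T;T⁻¹] (leftOp S), h.lift_leftOp_rel⟩

theorem regularRep_gen (h : ExchangeSystem S) (s : S) :
    h.regularRep (gen S s) = leftOp S s := by
  have h1 := RingQuot.liftAlgHom_mkAlgHom_apply ℤ[T;T⁻¹] (FreeAlgebra.lift ℤ[T;T⁻¹] (leftOp S))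
    h.lift_leftOp_rel (FreeAlgebra.ι _ s)
  rw [FreeAlgebra.lift_ι_apply] at h1
  exact h1

/-- A reduced word of an element. -/
noncomputable def redWord (h : ExchangeSystem S) (w : G) : List S :=
  (h.exists_isRed w).choose

theorem isRed_redWord (h : ExchangeSystem S) (w : G) : IsRed (h.redWord w) :=
  (h.exists_isRed w).choose_spec.1

theorem wprod_redWord (h : ExchangeSystem S) (w : G) : wprod (h.redWord w) = w :=
  (h.exists_isRed w).choose_spec.2

/-- The element `T_w` of the Hecke algebra. -/
noncomputable def tw (h : ExchangeSystem S) (w : G) : Hecke S :=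
  ((h.redWord w).map (gen S)).prod

/-- By Matsumoto's theorem the choice made in `redWord` is immaterial. -/
theorem tw_wprod (h : ExchangeSystem S) {ω : List S} (hω : IsRed ω) :
    h.tw (wprod ω) = (ω.map (gen S)).prod :=
  prod_map_eq_of_isRed h (gen S) (gen_braid S) (h.isRed_redWord _) hω (h.wprod_redWord _)

theorem tw_one (h : ExchangeSystem S) : h.tw 1 = 1 :=
  h.tw_wprod (ω := []) (by simp [IsRed])

theorem tw_simple (h : ExchangeSystem S) (s : S) : h.tw s = gen S s := by
  have := h.tw_wprod (ω := [s]) (by simp [IsRed, h.len_simple])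
  simpa using this

theorem tw_mul (h : ExchangeSystem S) {u w : G} (huw : len S (u * w) = len S u + len S w) :
    h.tw (u * w) = h.tw u * h.tw w := by
  obtain ⟨ω, h1, rfl⟩ := h.exists_isRed u
  obtain ⟨ω', h2, rfl⟩ := h.exists_isRed w
  rw [h1, h2, ← wprod_append] at huw
  rw [h.tw_wprod h1, h.tw_wprod h2, ← wprod_append, h.tw_wprod (by simpa [IsRed] using huw)]
  simp

theorem gen_mul_tw_of_lt (h : ExchangeSystem S) {s : S} {w : G}
    (hs : len S w < len S (s * w)) : gen S s * h.tw w = h.tw (s * w) := by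
  have := h.len_simple_mul w s
  rw [h.tw_mul (by rw [h.len_simple]; omega), h.tw_simple]

theorem gen_mul_tw_of_gt (h : ExchangeSystem S) {s : S} {w : G}
    (hs : len S (s * w) < len S w) :
    gen S s * h.tw w = h.tw (s * w) + (q - qinv) • h.tw w := by
  have h1 := h.gen_mul_tw_of_lt (s := s) (w := s * w) (by rwa [h.mul_cancel_left])
  rw [h.mul_cancel_left] at h1
  rw [← h1, ← mul_assoc, gen_mul_gen, add_mul, one_mul, smul_mul_assoc]

theorem regularRep_tw (h : ExchangeSystem S) (w : G) :
    h.regularRep (h.tw w) (Finsupp.single 1 1) = Finsupp.single w 1 := by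
  obtain ⟨ω, h1, rfl⟩ := h.exists_isRed w
  rw [h.tw_wprod h1]
  induction ω with
  | nil => simp
  | cons s ω ih =>
    have h2 := h1.tail h
    rw [List.map_cons, List.prod_cons, map_mul, Module.End.mul_apply, ih h2, regularRep_gen,
      leftOp_single, wprod_cons, if_pos, add_zero]
    rw [IsRed, wprod_cons] at h1
    rw [h1, h2, List.length_cons]
    omega

end ExchangeSystem

theorem adjoin_range_gen (S : Set G) :
    Algebra.adjoin ℤ[T;T⁻¹] (Set.range (gen S)) = ⊤ := by
  have h1 : Set.range (gen S) = toHecke S '' Set.range (FreeAlgebra.ι ℤ[T;T⁻¹]) := by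
    rw [← Set.range_comp]; rfl
  rw [h1, ← AlgHom.map_adjoin, FreeAlgebra.adjoin_range_ι, Algebra.map_top,
    AlgHom.range_eq_top]
  exact RingQuot.mkAlgHom_surjective _ _

/-- Induction principle for left ideals of the Hecke algebra. -/
theorem submodule_eq_top_of_gen_mul_mem {P : Submodule ℤ[T;T⁻¹] (Hecke S)} (h1 : 1 ∈ P)
    (hP : ∀ s, ∀ x ∈ P, gen S s * x ∈ P) : P = ⊤ := by
  rw [eq_top_iff]
  rintro a -
  have ha : a ∈ Algebra.adjoin ℤ[T;T⁻¹] (Set.range (gen S)) :=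
    adjoin_range_gen S ▸ Algebra.mem_top
  suffices ∀ x ∈ P, a * x ∈ P by simpa using this 1 h1
  induction ha using Algebra.adjoin_induction with
  | mem x hx => obtain ⟨s, rfl⟩ := hx; exact hP s
  | algebraMap r => intro x hx; rw [← Algebra.smul_def]; exact P.smul_mem r hx
  | add x y _ _ hx hy => intro z hz; rw [add_mul]; exact P.add_mem (hx z hz) (hy z hz)
  | mul x y _ _ hx hy => intro z hz; rw [mul_assoc]; exact hx _ (hy z hz)

namespace ExchangeSystem

theorem span_range_tw (h : ExchangeSystem S) :
    Submodule.span ℤ[T;T⁻¹] (Set.range h.tw) = ⊤ := by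
  refine submodule_eq_top_of_gen_mul_mem (Submodule.subset_span ⟨1, h.tw_one⟩) fun s x hx => ?_
  induction hx using Submodule.span_induction with
  | mem x hx =>
    obtain ⟨w, rfl⟩ := hx
    rcases h.len_simple_mul w s with hs | hs
    · rw [h.gen_mul_tw_of_lt (by omega)]
      exact Submodule.subset_span ⟨_, rfl⟩
    · rw [h.gen_mul_tw_of_gt (by omega)]
      exact Submodule.add_mem _ (Submodule.subset_span ⟨_, rfl⟩)
        (Submodule.smul_mem _ _ (Submodule.subset_span ⟨_, rfl⟩))
  | zero => simp
  | add x y _ _ hx hy => rw [mul_add]; exact Submodule.add_mem _ hx hy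
  | smul a x _ hx => rw [mul_smul_comm]; exact Submodule.smul_mem _ _ hx

/-- The regular representation, evaluated at the vector of 1, sends the `T_w` to the standard basis.
-/
theorem linearIndependent_tw (h : ExchangeSystem S) :
    LinearIndependent ℤ[T;T⁻¹] h.tw := by
  let ev : Hecke S →ₗ[ℤ[T;T⁻¹]] (G →₀ ℤ[T;T⁻¹]) :=
    LinearMap.applyₗ (Finsupp.single 1 1) ∘ₗ h.regularRep.toLinearMap
  refine LinearIndependent.of_comp ev ?_
  have : ev ∘ h.tw = fun w => Finsupp.single w 1 := funext h.regularRep_tw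
  rw [this]
  exact Finsupp.linearIndependent_single_one _ _

/-- The basis `(T_w)` of the Hecke algebra. -/
noncomputable def heckeBasis (h : ExchangeSystem S) : Module.Basis G ℤ[T;T⁻¹] (Hecke S) :=
  Module.Basis.mk h.linearIndependent_tw h.span_range_tw.ge

@[simp] theorem heckeBasis_apply (h : ExchangeSystem S) (w : G) : h.heckeBasis w = h.tw w :=
  Module.Basis.mk_apply _ _ w

end ExchangeSystem

end HeckeBasis
-- Coxeter systems as exchange systems, and the Bruhat order.
theorem exchangeSystem_range_simple {B : Type*} {W : Type u} [Group W] {M : CoxeterMatrix B}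
    (cs : CoxeterSystem M W) : ExchangeSystem (Set.range cs.simple) where
  mul_self := by
    rintro ⟨_, i, rfl⟩
    exact cs.simple_mul_simple_self i
  closure_eq_top := cs.subgroup_closure_range_simple
  len_mul_ne := by
    rintro w ⟨_, i, rfl⟩
    rw [len_eq_length, len_eq_length]
    exact cs.length_mul_simple_ne w i
  exchange := by
    rintro ω ⟨_, i, rfl⟩ h
    obtain ⟨ω, rfl⟩ : ∃ ω' : List B, ω'.map (Set.rangeFactorization cs.simple) = ω :=
      (List.map_surjective_iff.2 Set.rangeFactorization_surjective) ω
    have h1 : ∀ ω : List B, wprod (ω.map (Set.rangeFactorization cs.simple)) = cs.wordProd ω := by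
      intro ω
      rw [wprod, List.map_map]
      rfl
    rw [len_eq_length, len_eq_length, h1] at h
    obtain ⟨j, hj, hj'⟩ := exists_eraseIdx_of_isRightDescent cs ω i h
    refine ⟨j, by simpa using hj, ?_⟩
    rw [h1, hj', List.eraseIdx_map, h1]

section BruhatOrder

variable {G : Type u} [Group G] {S : Set G}

theorem len_le_of_bruhatLE {u w : G} (h : BruhatLE S u w) : len S u ≤ len S w := by
  induction h with
  | single h => exact h.1
  | tail _ h ih => exact ih.trans h.1

theorem bruhatLT_simple_mul_iff (h : ExchangeSystem S) {s : G} (hs : s ∈ S) (w : G) :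
    BruhatLT S w (s * w) ↔ len S w < len S (s * w) := by
  have h1 := h.len_simple_mul w ⟨s, hs⟩
  constructor
  · intro h2
    have := len_le_of_bruhatLE h2.1
    dsimp only at h1
    omega
  · intro h2
    refine ⟨.single ⟨h2.le, s, .inl ⟨s, hs, 1, by simp⟩, rfl⟩, fun e => ?_⟩
    rw [← e] at h2
    exact h2.false

theorem bruhatLT_simple_mul_iff' (h : ExchangeSystem S) {s : G} (hs : s ∈ S) (w : G) :
    BruhatLT S (s * w) w ↔ len S (s * w) < len S w := by
  have := bruhatLT_simple_mul_iff h hs (s * w)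
  rwa [h.mul_cancel_left ⟨s, hs⟩] at this

/-- The defining steps only require `≤` of lengths, but multiplication by a reflection never
preserves the length, so a step is trivial or strict. -/
theorem len_lt_of_bruhatLT {B : Type*} {W : Type u} [Group W] {M : CoxeterMatrix B}
    (cs : CoxeterSystem M W) {u w : W} (h : BruhatLT (Set.range cs.simple) u w) :
    len (Set.range cs.simple) u < len (Set.range cs.simple) w := by
  obtain ⟨h1, h2⟩ := h
  have key : u = w ∨ len (Set.range cs.simple) u < len (Set.range cs.simple) w := by
    have step : ∀ {x y : W}, (len (Set.range cs.simple) x ≤ len (Set.range cs.simple) y ∧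
        ∃ t, (t ∈ reflections (Set.range cs.simple) ∨ t = 1) ∧ y = t * x) →
        x = y ∨ len (Set.range cs.simple) x < len (Set.range cs.simple) y := by
      rintro x _ ⟨h3, t, ⟨_, ⟨i, rfl⟩, v, rfl⟩ | rfl, rfl⟩
      · right
        refine lt_of_le_of_ne h3 fun e => ?_
        rw [len_eq_length, len_eq_length] at e
        exact CoxeterSystem.IsReflection.length_mul_right_ne ⟨v⁻¹, i, by simp⟩ x e.symm
      · left; simp
    induction h1 with
    | single h => exact step h
    | @tail y z h3 h4 ih =>
      by_cases huy : u = y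
      · subst huy; exact step h4
      · have h5 := ih huy
        have h6 := h4.1
        right
        rcases h5 with h5 | h5
        · exact absurd h5 huy
        · omega
  exact key.resolve_left h2

end BruhatOrder

/-! ### Parabolic subgroups and distinguished coset representatives. -/

section Parabolic

variable {W : Type u} [Group W] {S K : Set W}

/-- An element of `K ⊆ W_K`, seen as an element of `S`. -/
def inclGen (hK : K ⊆ S) (s : within K K) : S := ⟨((s : parabolic K) : W), hK s.2⟩

/-- A word in the elements of `K ⊆ W_K`, seen as a word in `S`. -/
def liftWord (hK : K ⊆ S) (ω : List (within K K)) : List S :=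
  ω.map (inclGen hK)

theorem wprod_liftWord (hK : K ⊆ S) (ω : List (within K K)) :
    wprod (liftWord hK ω) = (wprod ω : parabolic K) := by
  induction ω with
  | nil => rfl
  | cons s ω ih => rw [wprod_cons, Subgroup.coe_mul, ← ih]; rfl

namespace ExchangeSystem

theorem exists_word_within (h : ExchangeSystem S) (hK : K ⊆ S) (z : parabolic K) :
    ∃ ω : List (within K K), wprod ω = z := by
  obtain ⟨z, hz⟩ := z
  induction hz using Subgroup.closure_induction with
  | mem x hx => exact ⟨[⟨⟨x, Subgroup.subset_closure hx⟩, hx⟩], by simp⟩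
  | one => exact ⟨[], rfl⟩
  | mul x y hx' hy' hx hy =>
    obtain ⟨ω, hω⟩ := hx
    obtain ⟨ω', hω'⟩ := hy
    exact ⟨ω ++ ω', by rw [wprod_append, hω, hω']; rfl⟩
  | inv x hx' hx =>
    obtain ⟨ω, hω⟩ := hx
    refine ⟨ω.reverse, Subtype.ext ?_⟩
    have h1 : liftWord hK ω.reverse = (liftWord hK ω).reverse := List.map_reverse
    rw [← wprod_liftWord hK, h1, h.wprod_reverse, wprod_liftWord hK, hω]

/-- If the first letter shortened the lifted tail, exchange in `W` would delete a letter of the tail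
and leave a shorter word, still in `K`. Minimality among words in `K` is spelled out because the
exchange condition for `W_K` is derived from this lemma. -/
theorem isRed_liftWord (h : ExchangeSystem S) (hK : K ⊆ S) {ω : List (within K K)}
    (hω : ∀ ω' : List (within K K), wprod ω' = wprod ω → ω.length ≤ ω'.length) :
    IsRed (liftWord hK ω) := by
  induction ω with
  | nil => simp [IsRed, liftWord]
  | cons s ω ih =>
    have h1 := ih fun ω' e => by
      have := hω (s :: ω') (by simp [e])
      simpa using this
    have h2 := h.len_simple_mul (wprod (liftWord hK ω)) (inclGen hK s)
    have h3 : wprod (liftWord hK (s :: ω)) = ((s : parabolic K) : W) * wprod (liftWord hK ω) := rfl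
    have h5 : (liftWord hK (s :: ω)).length = (liftWord hK ω).length + 1 := rfl
    rw [IsRed, h3, h5, ← h1]
    refine h2.resolve_right fun h4 => ?_
    obtain ⟨j, hj, hj'⟩ := h.exchange_left (liftWord hK ω) (inclGen hK s)
      (by omega)
    rw [liftWord, List.eraseIdx_map] at hj'
    have h6 : wprod (ω.eraseIdx j) = wprod (s :: ω) := by
      apply Subtype.ext
      rw [← wprod_liftWord hK, ← wprod_liftWord hK, h3]
      exact hj'.symm
    have h7 := hω _ h6
    rw [liftWord, List.length_map] at hj
    rw [List.length_eraseIdx_of_lt hj, List.length_cons] at h7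
    omega

theorem len_within (h : ExchangeSystem S) (hK : K ⊆ S) (z : parabolic K) :
    len (within K K) z = len S (z : W) := by
  have hne : {n | ∃ ω : List (within K K), ω.length = n ∧ wprod ω = z}.Nonempty := by
    obtain ⟨ω, hω⟩ := h.exists_word_within hK z
    exact ⟨_, ω, rfl, hω⟩
  obtain ⟨ω, h1, h2⟩ := Nat.sInf_mem hne
  have h3 := h.isRed_liftWord hK (ω := ω) fun ω' e => by
    rw [h1]
    exact Nat.sInf_le ⟨ω', rfl, e.trans h2⟩
  rw [IsRed, wprod_liftWord, h2] at h3
  rw [len_eq_sInf, ← h1, h3, liftWord, List.length_map]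

/-- Exchange in `W` only deletes letters, so a word in `K` stays a word in `K`; and the two lengths
agree by `len_within`. -/
theorem within_self (h : ExchangeSystem S) (hK : K ⊆ S) : ExchangeSystem (within K K) where
  mul_self s := Subtype.ext (h.mul_self (inclGen hK s))
  closure_eq_top := Subgroup.closure_closure_coe_preimage
  len_mul_ne w s := by
    rw [h.len_within hK, h.len_within hK]
    exact h.len_mul_ne w (inclGen hK s)
  exchange ω s hs := by
    rw [h.len_within hK, h.len_within hK, Subgroup.coe_mul, ← wprod_liftWord hK] at hs
    obtain ⟨j, hj, hj'⟩ := h.exchange (liftWord hK ω) (inclGen hK s) hs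
    refine ⟨j, by simpa [liftWord] using hj, Subtype.ext ?_⟩
    rw [liftWord, List.eraseIdx_map] at hj'
    rw [Subgroup.coe_mul, ← wprod_liftWord hK, ← wprod_liftWord hK]
    exact hj'

/-- Reduced words of `d` and `z` concatenate to a reduced word. Otherwise exchange would delete a
letter of the first, giving a shorter element of `d W_K`, or a letter of the second, giving too
short a word for an element of `W_K`. -/
theorem len_mul_of_minimal (h : ExchangeSystem S) (hK : K ⊆ S) {d : W}
    (hd : ∀ k : parabolic K, len S d ≤ len S (d * k)) (z : parabolic K) :
    len S (d * z) = len S d + len S (z : W) := by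
  have hKK := h.within_self hK
  obtain ⟨ω, hω, rfl⟩ := hKK.exists_isRed z
  induction ω using List.reverseRecOn with
  | nil => simp
  | append_singleton ω s ih =>
    have hω' := hω.of_append_left hKK
    have ih := ih hω'
    let s' : S := (inclGen hK s)
    have e1 : ((wprod (ω ++ [s]) : parabolic K) : W) = (wprod ω : parabolic K) * s' := by
      simp [s', inclGen]
    have hl : len S ((wprod (ω ++ [s]) : parabolic K) : W) =
        len S ((wprod ω : parabolic K) : W) + 1 := by
      rw [← h.len_within hK, ← h.len_within hK, hω, hω']
      simp
    obtain ⟨α, hα, rfl⟩ := h.exists_isRed d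
    have h1 := h.len_mul_simple (wprod α * (wprod ω : parabolic K)) s'
    rw [hl, e1, ← mul_assoc, ← add_assoc, ← ih]
    refine h1.resolve_right fun h2 => ?_
    have h3 := h.exchange (α ++ liftWord hK ω) s'
    rw [wprod_append, wprod_liftWord] at h3
    obtain ⟨j, hj, hj'⟩ := h3 (by omega)
    rw [List.length_append] at hj
    by_cases hjl : j < α.length
    · rw [List.eraseIdx_append_of_lt_length hjl, wprod_append, wprod_liftWord] at hj'
      have h4 := hd (wprod ω * s * (wprod ω)⁻¹)
      have h5 : wprod α * ((wprod ω * s * (wprod ω)⁻¹ : parabolic K) : W) =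
          wprod (α.eraseIdx j) := by
        rw [Subgroup.coe_mul, Subgroup.coe_mul, Subgroup.coe_inv, ← mul_assoc, ← mul_assoc]
        exact mul_inv_eq_of_eq_mul hj'
      rw [h5] at h4
      have h6 := len_wprod_le (α.eraseIdx j)
      rw [List.length_eraseIdx_of_lt hjl] at h6
      rw [IsRed] at hα
      omega
    · rw [List.eraseIdx_append_of_length_le (not_lt.1 hjl), wprod_append, mul_assoc,
        mul_right_inj, ← e1, liftWord, List.eraseIdx_map] at hj'
      have h6 := len_wprod_le (liftWord hK (ω.eraseIdx (j - α.length)))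
      rw [show wprod (liftWord hK (ω.eraseIdx (j - α.length))) = _ from hj'.symm, hl,
        ← h.len_within hK, hω', liftWord, List.length_map] at h6
      rw [liftWord, List.length_map] at hj
      rw [List.length_eraseIdx_of_lt (by omega)] at h6
      omega

theorem exists_minimal_mul (h : ExchangeSystem S) (hK : K ⊆ S) (w : W) :
    ∃ d ∈ minReps S K, ∃ z : parabolic K, w = d * z ∧
      ∀ k : parabolic K, len S d ≤ len S (d * k) := by
  obtain ⟨k₀, hk₀⟩ : ∃ k₀ : parabolic K, ∀ k : parabolic K,
      len S (w * k₀) ≤ len S (w * k) :=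
    ⟨_, fun a => Function.argmin_le (fun k : parabolic K => len S (w * k)) a⟩
  have h1 : ∀ k : parabolic K, len S (w * k₀) ≤ len S (w * k₀ * k) := fun k => by
    rw [mul_assoc, ← Subgroup.coe_mul]
    exact hk₀ _
  refine ⟨w * k₀, fun s hs => ?_, k₀⁻¹, by simp, h1⟩
  exact lt_of_le_of_ne (h1 ⟨s, Subgroup.subset_closure hs⟩)
    (h.len_mul_ne (w * k₀) ⟨s, hK hs⟩).symm

theorem eq_one_of_len_lt (h : ExchangeSystem S) {z : W}
    (hz : ∀ s : S, len S z < len S (z * s)) : z = 1 := by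
  obtain ⟨ω, h1, rfl⟩ := h.exists_isRed z
  rcases List.eq_nil_or_concat ω with rfl | ⟨ω', u, rfl⟩
  · rfl
  · rw [List.concat_eq_append] at *
    have h2 := hz u
    rw [h1, wprod_append, wprod_cons, wprod_nil, mul_one, h.mul_cancel_right,
      h1.of_append_left h] at h2
    simp at h2

/-- Membership in `minReps` tests only the elements of `K`. Let `d = d₀ z` with `d₀` shortest in the
coset: as lengths add, every `s ∈ K` lengthens `z` on the right, so `z = 1`. -/
theorem len_le_of_mem_minReps (h : ExchangeSystem S) (hK : K ⊆ S) {d : W}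
    (hd : d ∈ minReps S K) (k : parabolic K) : len S d ≤ len S (d * k) := by
  obtain ⟨d₀, -, z, rfl, hmin⟩ := h.exists_minimal_mul hK d
  obtain rfl : z = 1 := by
    refine (h.within_self hK).eq_one_of_len_lt fun s => ?_
    have h1 := hd _ s.2
    rw [mul_assoc, ← Subgroup.coe_mul, h.len_mul_of_minimal hK hmin,
      h.len_mul_of_minimal hK hmin] at h1
    rw [h.len_within hK, h.len_within hK]
    omega
  simpa using hmin k

theorem len_mul_of_mem_minReps (h : ExchangeSystem S) (hK : K ⊆ S) {d : W}
    (hd : d ∈ minReps S K) (z : parabolic K) :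
    len S (d * z) = len S d + len S (z : W) :=
  h.len_mul_of_minimal hK (h.len_le_of_mem_minReps hK hd) z

theorem eq_of_mul_eq_mul (h : ExchangeSystem S) (hK : K ⊆ S) {d d' : W}
    (hd : d ∈ minReps S K) (hd' : d' ∈ minReps S K) {z z' : parabolic K}
    (he : d * z = d' * z') : d = d' ∧ z = z' := by
  have e1 : d' = d * ((z * z'⁻¹ : parabolic K) : W) := by
    rw [Subgroup.coe_mul, ← mul_assoc, he]; simp
  have h1 := h.len_mul_of_mem_minReps hK hd (z * z'⁻¹)
  have h2 := h.len_le_of_mem_minReps hK hd' (z * z'⁻¹)⁻¹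
  have e2 : d' * (((z * z'⁻¹)⁻¹ : parabolic K) : W) = d := by
    rw [e1, mul_assoc, ← Subgroup.coe_mul, mul_inv_cancel, Subgroup.coe_one, mul_one]
  rw [← e1] at h1
  rw [e2] at h2
  have h3 := h.eq_one_of_len_eq_zero (w := ((z * z'⁻¹ : parabolic K) : W)) (by omega)
  rw [h3, mul_one] at e1
  exact ⟨e1.symm, mul_inv_eq_one.1 (Subtype.ext h3)⟩

/-- Deodhar's lemma. -/
theorem simple_mul_mem_minReps_or (h : ExchangeSystem S) (hK : K ⊆ S) {d : W}
    (hd : d ∈ minReps S K) (s : S) :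
    (s : W) * d ∈ minReps S K ∨ ∃ t : within K K, (s : W) * d = d * (t : parabolic K) := by
  by_cases hsd : (s : W) * d ∈ minReps S K
  · exact .inl hsd
  right
  simp only [minReps, Set.mem_ofPred_eq, not_forall] at hsd
  obtain ⟨t, ht, hlt⟩ := hsd
  have h1 := hd t ht
  have h2 := h.len_simple_mul d s
  have h3 := h.len_mul_simple d ⟨t, hK ht⟩
  have h4 := h.len_mul_simple (s * d) ⟨t, hK ht⟩
  have h5 := h.len_simple_mul (d * t) s
  rw [← mul_assoc] at h5
  dsimp only at h3 h4
  -- Here `t` lengthens `d` but shortens `s d`. This forces `s d` to be longer than `d`, and the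
  -- folding condition gives `s d = d t`.
  exact ⟨⟨⟨t, Subgroup.subset_closure ht⟩, ht⟩,
    h.mul_eq_mul_of_len (t := ⟨t, hK ht⟩) (by omega) h1 (by dsimp only; omega)⟩

end ExchangeSystem

end Parabolic
-- The structure of the induced module.
section InducedModule

open scoped TensorProduct

variable {W : Type u} [Group W] {S K : Set W}

theorem gen_inclGen (hK : K ⊆ S) (s : within K K) :
    heckeIncl hK (gen (within K K) s) = gen S (inclGen hK s) :=
  heckeIncl_gen hK s

theorem heckeIncl_tw (h : ExchangeSystem S) (hK : K ⊆ S) (z : parabolic K) :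
    heckeIncl hK ((h.within_self hK).tw z) = h.tw z := by
  obtain ⟨ω, h1, rfl⟩ := (h.within_self hK).exists_isRed z
  have h2 : IsRed (liftWord hK ω) := by
    rw [IsRed, wprod_liftWord, ← h.len_within hK, h1, liftWord, List.length_map]
  rw [(h.within_self hK).tw_wprod h1, ← wprod_liftWord hK, h.tw_wprod h2, map_list_prod,
    liftWord, List.map_map, List.map_map]
  congr 1
  exact List.map_congr_left fun s _ => gen_inclGen hK s

/-- The factorization of elements of `W` as `d z` with `d ∈ D_K` and `z ∈ W_K`. -/
noncomputable def cosetEquiv (h : ExchangeSystem S) (hK : K ⊆ S) :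
    minReps S K × parabolic K ≃ W :=
  Equiv.ofBijective (fun p => (p.1 : W) * p.2) ⟨fun p p' e => by
    obtain ⟨h1, h2⟩ := h.eq_of_mul_eq_mul hK p.1.2 p'.1.2 e
    exact Prod.ext (Subtype.ext h1) h2, fun w => by
    obtain ⟨d, hd, z, rfl, -⟩ := h.exists_minimal_mul hK w
    exact ⟨(⟨d, hd⟩, z), rfl⟩⟩

theorem cosetEquiv_apply (h : ExchangeSystem S) (hK : K ⊆ S) (p : minReps S K × parabolic K) :
    cosetEquiv h hK p = (p.1 : W) * p.2 := rfl

variable {𝒮₀ : Type v} [AddCommGroup 𝒮₀] [Module ℤ[T;T⁻¹] 𝒮₀]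
  [Module (Hecke (within K K)) 𝒮₀]

/-- The element `h ⊗ m` of the induced module. -/
noncomputable def indMk (hK : K ⊆ S) (a : Hecke S) (m : 𝒮₀) : Induced hK 𝒮₀ :=
  Submodule.Quotient.mk (a ⊗ₜ[ℤ[T;T⁻¹]] m)

theorem smul_indMk (hK : K ⊆ S) (a b : Hecke S) (m : 𝒮₀) :
    a • indMk hK b m = indMk hK (a * b) m := rfl

theorem indMk_mul (hK : K ⊆ S) (a : Hecke S) (k : Hecke (within K K)) (m : 𝒮₀) :
    indMk hK (a * heckeIncl hK k) m = indMk hK a (k • m) :=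
  (Submodule.Quotient.eq _).2 (Submodule.subset_span ⟨a, k, m, rfl⟩)

theorem indMk_add_left (hK : K ⊆ S) (a b : Hecke S) (m : 𝒮₀) :
    indMk hK (a + b) m = indMk hK a m + indMk hK b m := by
  simp only [indMk, TensorProduct.add_tmul]; rfl

theorem indMk_smul_left (hK : K ⊆ S) (r : ℤ[T;T⁻¹]) (a : Hecke S) (m : 𝒮₀) :
    indMk hK (r • a) m = r • indMk hK a m := rfl

/-- `h ⊗ m` as a linear map in `m`. -/
noncomputable def indMkₗ (hK : K ⊆ S) (a : Hecke S) : 𝒮₀ →ₗ[ℤ[T;T⁻¹]] Induced hK 𝒮₀ where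
  toFun := indMk hK a
  map_add' m n := by simp only [indMk, TensorProduct.tmul_add]; rfl
  map_smul' r m := by simp only [indMk, TensorProduct.tmul_smul]; rfl

theorem indMkₗ_apply (hK : K ⊆ S) (a : Hecke S) (m : 𝒮₀) : indMkₗ hK a m = indMk hK a m := rfl

theorem bar_bar (S : Set W) (a : Hecke S) : bar S (bar S a) = a := by
  have ha : a ∈ Algebra.adjoin ℤ[T;T⁻¹] (Set.range (gen S)) :=
    adjoin_range_gen S ▸ Algebra.mem_top
  induction ha using Algebra.adjoin_induction with
  | mem x hx =>
    obtain ⟨s, rfl⟩ := hx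
    rw [bar_gen, map_sub, bar_gen, Algebra.smul_def, mul_one, bar_algebraMap, map_sub barA,
      barA_q, barA_qinv, ← neg_sub q qinv, map_neg, sub_neg_eq_add, sub_add_cancel]
  | algebraMap r =>
    rw [bar_algebraMap, bar_algebraMap]
    congr 1
    exact (LaurentPolynomial.involutive_invert r :)
  | add x y _ _ hx hy => rw [map_add, map_add, hx, hy]
  | mul x y _ _ hx hy => rw [map_mul, map_mul, hx, hy]

/-- This makes `h ⊗ m ↦ bar h ⊗ β m` compatible with the relations `h k ⊗ m = h ⊗ k m`. -/
theorem bar_heckeIncl (hK : K ⊆ S) (k : Hecke (within K K)) :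
    bar S (heckeIncl hK k) = heckeIncl hK (bar (within K K) k) := by
  have hk : k ∈ Algebra.adjoin ℤ[T;T⁻¹] (Set.range (gen (within K K))) :=
    adjoin_range_gen (within K K) ▸ Algebra.mem_top
  induction hk using Algebra.adjoin_induction with
  | mem x hx =>
    obtain ⟨s, rfl⟩ := hx
    rw [gen_inclGen, bar_gen, bar_gen, map_sub, map_smul, map_one, gen_inclGen]
  | algebraMap r => rw [AlgHom.commutes, bar_algebraMap, bar_algebraMap, AlgHom.commutes]
  | add x y _ _ hx hy => simp only [map_add, hx, hy]
  | mul x y _ _ hx hy => simp only [map_mul, hx, hy]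

theorem bar_smul (S : Set W) (r : ℤ[T;T⁻¹]) (a : Hecke S) :
    bar S (r • a) = barA r • bar S a := by
  rw [Algebra.smul_def, map_mul, bar_algebraMap, ← Algebra.smul_def]

/-- The bar involution of the Hecke algebra as a semilinear map. -/
noncomputable def barₛₗ (S : Set W) : Hecke S →ₛₗ[barA] Hecke S where
  toFun := bar S
  map_add' := map_add _
  map_smul' := bar_smul S

/-- The semilinear map `h ⊗ m ↦ bar h ⊗ β m` before passing to the quotient. -/
noncomputable def preIndBar (hK : K ⊆ S) (β : 𝒮₀ →ₛₗ[barA] 𝒮₀) :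
    Hecke S ⊗[ℤ[T;T⁻¹]] 𝒮₀ →ₛₗ[barA] Induced hK 𝒮₀ :=
  ((inducedRel hK 𝒮₀).mkQ.restrictScalars ℤ[T;T⁻¹]).comp (TensorProduct.map (barₛₗ S) β)

theorem preIndBar_rel (hK : K ⊆ S) (β : 𝒮₀ →ₛₗ[barA] 𝒮₀)
    (hβ : ∀ (k : Hecke (within K K)) (m : 𝒮₀), β (k • m) = bar (within K K) k • β m) :
    (inducedRel hK 𝒮₀).restrictScalars ℤ[T;T⁻¹] ≤ LinearMap.ker (preIndBar hK β) := by
  have htmul : ∀ a m, preIndBar hK β (a ⊗ₜ m) = indMk hK (bar S a) (β m) := fun _ _ => rfl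
  intro x hx
  -- The relations form an `ℋ`-submodule while the map is only semilinear over `𝒜`, so the induction
  -- must treat all left multiples at once.
  suffices ∀ a : Hecke S, preIndBar hK β (a • x) = 0 by simpa using this 1
  replace hx : x ∈ inducedRel hK 𝒮₀ := hx
  induction hx using Submodule.span_induction with
  | mem x hx =>
    obtain ⟨b, k, m, rfl⟩ := hx
    intro a
    rw [smul_sub, map_sub, sub_eq_zero, TensorProduct.smul_tmul', TensorProduct.smul_tmul',
      smul_eq_mul, smul_eq_mul, ← mul_assoc, htmul, htmul, map_mul, bar_heckeIncl, indMk_mul, hβ]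
  | zero => simp
  | add x y _ _ hx hy => intro a; rw [smul_add, map_add, hx, hy, add_zero]
  | smul b x _ hx => intro a; rw [← mul_smul]; exact hx _

/-- The semilinear map `h ⊗ m ↦ bar h ⊗ β m` of the induced module. -/
noncomputable def indBar (hK : K ⊆ S) (β : 𝒮₀ →ₛₗ[barA] 𝒮₀)
    (hβ : ∀ (k : Hecke (within K K)) (m : 𝒮₀), β (k • m) = bar (within K K) k • β m) :
    Induced hK 𝒮₀ →ₛₗ[barA] Induced hK 𝒮₀ :=
  (Submodule.liftQ ((inducedRel hK 𝒮₀).restrictScalars ℤ[T;T⁻¹]) (preIndBar hK β)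
    (preIndBar_rel hK β hβ)).comp
    (Submodule.Quotient.restrictScalarsEquiv ℤ[T;T⁻¹] (inducedRel hK 𝒮₀)).symm.toLinearMap

theorem indBar_indMk (hK : K ⊆ S) (β : 𝒮₀ →ₛₗ[barA] 𝒮₀)
    (hβ : ∀ (k : Hecke (within K K)) (m : 𝒮₀), β (k • m) = bar (within K K) k • β m)
    (a : Hecke S) (m : 𝒮₀) : indBar hK β hβ (indMk hK a m) = indMk hK (bar S a) (β m) := rfl

theorem induced_induction (hK : K ⊆ S) {p : Induced hK 𝒮₀ → Prop} (x : Induced hK 𝒮₀)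
    (h0 : p 0) (hadd : ∀ x y, p x → p y → p (x + y)) (hmk : ∀ a m, p (indMk hK a m)) : p x := by
  obtain ⟨x, rfl⟩ := Submodule.Quotient.mk_surjective _ x
  induction x using TensorProduct.induction_on with
  | zero => exact h0
  | add x y hx hy => exact hadd _ _ hx hy
  | tmul a m => exact hmk a m

theorem indBar_smul (hK : K ⊆ S) (β : 𝒮₀ →ₛₗ[barA] 𝒮₀)
    (hβ : ∀ (k : Hecke (within K K)) (m : 𝒮₀), β (k • m) = bar (within K K) k • β m)
    (a : Hecke S) (x : Induced hK 𝒮₀) :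
    indBar hK β hβ (a • x) = bar S a • indBar hK β hβ x := by
  induction x using induced_induction with
  | h0 => rw [smul_zero, map_zero, smul_zero]
  | hadd x y hx hy => rw [smul_add, map_add, map_add, hx, hy, smul_add]
  | hmk b m => rw [smul_indMk, indBar_indMk, indBar_indMk, map_mul, smul_indMk]

theorem indBar_involutive (hK : K ⊆ S) (β : 𝒮₀ →ₛₗ[barA] 𝒮₀)
    (hβ : ∀ (k : Hecke (within K K)) (m : 𝒮₀), β (k • m) = bar (within K K) k • β m)
    (hinv : Function.Involutive β) : Function.Involutive (indBar hK β hβ) := by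
  intro x
  induction x using induced_induction with
  | h0 => rw [map_zero, map_zero]
  | hadd x y hx hy => rw [map_add, map_add, hx, hy]
  | hmk b m => rw [indBar_indMk, indBar_indMk, bar_bar, hinv]

variable [IsScalarTower ℤ[T;T⁻¹] (Hecke (within K K)) 𝒮₀]

/-- The map `T_{dz} ⊗ m ↦ (d, T_z m)`. -/
noncomputable def indToFinsupp (h : ExchangeSystem S) (hK : K ⊆ S) (𝒮₀ : Type v)
    [AddCommGroup 𝒮₀] [Module ℤ[T;T⁻¹] 𝒮₀] [Module (Hecke (within K K)) 𝒮₀]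
    [IsScalarTower ℤ[T;T⁻¹] (Hecke (within K K)) 𝒮₀] :
    Hecke S ⊗[ℤ[T;T⁻¹]] 𝒮₀ →ₗ[ℤ[T;T⁻¹]] (minReps S K →₀ 𝒮₀) :=
  TensorProduct.lift <| h.heckeBasis.constr ℤ[T;T⁻¹] fun w =>
    Finsupp.lsingle ((cosetEquiv h hK).symm w).1 ∘ₗ
      Algebra.lsmul ℤ[T;T⁻¹] ℤ[T;T⁻¹] 𝒮₀ ((h.within_self hK).tw ((cosetEquiv h hK).symm w).2)

theorem indToFinsupp_tw (h : ExchangeSystem S) (hK : K ⊆ S) (d : minReps S K) (z : parabolic K)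
    (m : 𝒮₀) : indToFinsupp h hK 𝒮₀ (h.tw (d * z) ⊗ₜ m) =
      Finsupp.single d ((h.within_self hK).tw z • m) := by
  rw [indToFinsupp, TensorProduct.lift.tmul, ← h.heckeBasis_apply, Module.Basis.constr_basis,
    ← cosetEquiv_apply h hK (d, z), Equiv.symm_apply_apply]
  rfl

theorem tw_mul_heckeIncl_tw (h : ExchangeSystem S) (hK : K ⊆ S) (d : minReps S K)
    (z : parabolic K) :
    h.tw d * heckeIncl hK ((h.within_self hK).tw z) = h.tw (d * z) := by
  rw [heckeIncl_tw, h.tw_mul (h.len_mul_of_mem_minReps hK d.2 z)]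

theorem indToFinsupp_tw_mul (h : ExchangeSystem S) (hK : K ⊆ S) (d : minReps S K)
    (k : Hecke (within K K)) (m : 𝒮₀) :
    indToFinsupp h hK 𝒮₀ ((h.tw d * heckeIncl hK k) ⊗ₜ m) = Finsupp.single d (k • m) := by
  have hk : k ∈ Submodule.span ℤ[T;T⁻¹] (Set.range (h.within_self hK).tw) :=
    (h.within_self hK).span_range_tw ▸ Submodule.mem_top
  induction hk using Submodule.span_induction with
  | mem x hx =>
    obtain ⟨z, rfl⟩ := hx
    rw [tw_mul_heckeIncl_tw, indToFinsupp_tw]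
  | zero => simp
  | add x y _ _ hx hy =>
    rw [map_add, mul_add, TensorProduct.add_tmul, map_add, hx, hy, add_smul, Finsupp.single_add]
  | smul r x _ hx =>
    rw [map_smul, mul_smul_comm, ← TensorProduct.smul_tmul', map_smul, hx, smul_assoc,
      Finsupp.smul_single]

/-- For `a = T_d T_z` both sides are concentrated at `d` with value `T_z k m`, and these products
span `ℋ`. -/
theorem indToFinsupp_rel (h : ExchangeSystem S) (hK : K ⊆ S) (a : Hecke S)
    (k : Hecke (within K K)) (m : 𝒮₀) :
    indToFinsupp h hK 𝒮₀ ((a * heckeIncl hK k) ⊗ₜ m) =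
      indToFinsupp h hK 𝒮₀ (a ⊗ₜ (k • m)) := by
  have ha : a ∈ Submodule.span ℤ[T;T⁻¹] (Set.range h.tw) :=
    h.span_range_tw ▸ Submodule.mem_top
  induction ha using Submodule.span_induction with
  | mem x hx =>
    obtain ⟨w, rfl⟩ := hx
    obtain ⟨⟨d, z⟩, rfl⟩ := (cosetEquiv h hK).surjective w
    rw [cosetEquiv_apply, ← tw_mul_heckeIncl_tw h hK, mul_assoc, ← map_mul, indToFinsupp_tw_mul,
      indToFinsupp_tw_mul, mul_smul]
  | zero => simp
  | add x y _ _ hx hy =>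
    rw [add_mul, TensorProduct.add_tmul, TensorProduct.add_tmul, map_add, map_add, hx, hy]
  | smul r x _ hx =>
    rw [smul_mul_assoc, ← TensorProduct.smul_tmul', ← TensorProduct.smul_tmul', map_smul,
      map_smul, hx]

theorem inducedRel_le_ker (h : ExchangeSystem S) (hK : K ⊆ S) :
    (inducedRel hK 𝒮₀).restrictScalars ℤ[T;T⁻¹] ≤ LinearMap.ker (indToFinsupp h hK 𝒮₀) := by
  intro x hx
  suffices ∀ a : Hecke S, indToFinsupp h hK 𝒮₀ (a • x) = 0 by simpa using this 1
  replace hx : x ∈ inducedRel hK 𝒮₀ := hx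
  induction hx using Submodule.span_induction with
  | mem x hx =>
    obtain ⟨b, k, m, rfl⟩ := hx
    intro a
    rw [smul_sub, map_sub, sub_eq_zero, TensorProduct.smul_tmul', TensorProduct.smul_tmul',
      smul_eq_mul, smul_eq_mul, ← mul_assoc, indToFinsupp_rel]
  | zero => simp
  | add x y _ _ hx hy => intro a; rw [smul_add, map_add, hx, hy, add_zero]
  | smul b x _ hx => intro a; rw [← mul_smul]; exact hx _

/-- The induced module is the direct sum of the `T_d ⊗ 𝒮₀` with `d ∈ D_K`. -/
noncomputable def indEquiv (h : ExchangeSystem S) (hK : K ⊆ S) (𝒮₀ : Type v)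
    [AddCommGroup 𝒮₀] [Module ℤ[T;T⁻¹] 𝒮₀] [Module (Hecke (within K K)) 𝒮₀]
    [IsScalarTower ℤ[T;T⁻¹] (Hecke (within K K)) 𝒮₀] :
    Induced hK 𝒮₀ ≃ₗ[ℤ[T;T⁻¹]] (minReps S K →₀ 𝒮₀) :=
  LinearEquiv.ofLinearMap
    (Submodule.liftQ _ (indToFinsupp h hK 𝒮₀) (inducedRel_le_ker h hK) ∘ₗ
      (Submodule.Quotient.restrictScalarsEquiv ℤ[T;T⁻¹] (inducedRel hK 𝒮₀)).symm.toLinearMap)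
    (Finsupp.lsum ℤ[T;T⁻¹] fun d => indMkₗ hK (h.tw d))
    (by
      refine Finsupp.lhom_ext fun d m => ?_
      rw [LinearMap.comp_apply, Finsupp.lsum_single]
      change indToFinsupp h hK 𝒮₀ (h.tw d ⊗ₜ m) = _
      have := indToFinsupp_tw_mul h hK d 1 m
      rwa [map_one, mul_one, one_smul] at this)
    (by
      refine LinearMap.ext fun x => ?_
      obtain ⟨x, rfl⟩ := Submodule.Quotient.mk_surjective _ x
      induction x using TensorProduct.induction_on with
      | zero => simp
      | add x y hx hy => rw [Submodule.Quotient.mk_add, map_add, hx, hy, map_add]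
      | tmul a m =>
        change Finsupp.lsum ℤ[T;T⁻¹] (fun d : minReps S K => indMkₗ hK (h.tw d))
          (indToFinsupp h hK 𝒮₀ (a ⊗ₜ m)) = indMk hK a m
        have ha : a ∈ Submodule.span ℤ[T;T⁻¹] (Set.range h.tw) :=
          h.span_range_tw ▸ Submodule.mem_top
        induction ha using Submodule.span_induction with
        | mem x hx =>
          obtain ⟨w, rfl⟩ := hx
          obtain ⟨⟨d, z⟩, rfl⟩ := (cosetEquiv h hK).surjective w
          rw [cosetEquiv_apply, ← tw_mul_heckeIncl_tw h hK, indToFinsupp_tw_mul, Finsupp.lsum_single,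
            indMkₗ_apply, indMk_mul]
        | zero => simp [indMk]
        | add x y _ _ hx hy => rw [TensorProduct.add_tmul, map_add, map_add, hx, hy, indMk_add_left]
        | smul r x _ hx =>
          rw [← TensorProduct.smul_tmul', map_smul, map_smul, hx, indMk_smul_left])

theorem indEquiv_symm_single (h : ExchangeSystem S) (hK : K ⊆ S) (d : minReps S K) (m : 𝒮₀) :
    (indEquiv h hK 𝒮₀).symm (Finsupp.single d m) = indMk hK (h.tw d) m := by
  change Finsupp.lsum ℤ[T;T⁻¹] (fun d : minReps S K => indMkₗ hK (h.tw d)) (Finsupp.single d m) = _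
  rw [Finsupp.lsum_single, indMkₗ_apply]

variable {I₀ : Set (parabolic K)}

/-- The factorization of elements of `D_K I₀`. -/
noncomputable def idealEquiv (h : ExchangeSystem S) (hK : K ⊆ S) (I₀ : Set (parabolic K)) :
    (Σ _ : minReps S K, I₀) ≃ inducedIdeal S K I₀ :=
  Equiv.ofBijective (fun p => ⟨(p.1 : W) * (p.2 : parabolic K), p.1, p.1.2, p.2, p.2.2, rfl⟩)
    ⟨fun p p' e => by
      obtain ⟨h1, h2⟩ := h.eq_of_mul_eq_mul hK p.1.2 p'.1.2 (congrArg Subtype.val e)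
      exact Sigma.ext (Subtype.ext h1) (heq_of_eq (Subtype.ext h2)), by
      rintro ⟨_, d, hd, z, hz, rfl⟩
      exact ⟨⟨⟨d, hd⟩, ⟨z, hz⟩⟩, rfl⟩⟩

/-- The basis `T_d ⊗ b_z` of the induced module. -/
noncomputable def indBasis (h : ExchangeSystem S) (hK : K ⊆ S)
    (b : Module.Basis I₀ ℤ[T;T⁻¹] 𝒮₀) :
    Module.Basis (inducedIdeal S K I₀) ℤ[T;T⁻¹] (Induced hK 𝒮₀) :=
  ((Finsupp.basis fun _ : minReps S K => b).map (indEquiv h hK 𝒮₀).symm).reindex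
    (idealEquiv h hK I₀)

theorem indBasis_apply (h : ExchangeSystem S) (hK : K ⊆ S) (b : Module.Basis I₀ ℤ[T;T⁻¹] 𝒮₀)
    (d : minReps S K) (z : I₀) (hw : (d : W) * (z : parabolic K) ∈ inducedIdeal S K I₀) :
    indBasis h hK b ⟨d * (z : parabolic K), hw⟩ = indMk hK (h.tw d) (b z) := by
  have : (⟨d * (z : parabolic K), hw⟩ : inducedIdeal S K I₀) = idealEquiv h hK I₀ ⟨d, z⟩ := rfl
  rw [this, indBasis, Module.Basis.reindex_apply, Equiv.symm_apply_apply, Module.Basis.map_apply,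
    Finsupp.coe_basis, indEquiv_symm_single]

end InducedModule
-- The ideal `D_K I₀` and the formulas for the induced basis.
section InducedIdeal

variable {W : Type u} [Group W] {S K J : Set W} {I₀ : Set (parabolic K)}

theorem isWeakIdeal_of_step {G : Type u} [Group G] {S I : Set G}
    (hI : ∀ u : G, ∀ s ∈ S, len S u ≤ len S (s * u) → s * u ∈ I → u ∈ I) : IsWeakIdeal S I := by
  have step : ∀ u w : G, (len S u ≤ len S w ∧ ∃ s, (s ∈ S ∨ s = 1) ∧ w = s * u) →
      w ∈ I → u ∈ I := by
    rintro u _ ⟨hl, s, hs | rfl, rfl⟩ hw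
    · exact hI u s hs hl hw
    · simpa using hw
  intro u w huw
  induction huw with
  | single h => exact step _ _ h
  | tail _ h ih => exact fun hw => ih (step _ _ h hw)

theorem IsWeakIdeal.mem_of_simple_mul {G : Type u} [Group G] {S I : Set G} (hI : IsWeakIdeal S I)
    {u s : G} (hs : s ∈ S) (hl : len S u ≤ len S (s * u)) (hw : s * u ∈ I) : u ∈ I :=
  hI u (s * u) (.single ⟨hl, s, .inl hs, rfl⟩) hw

theorem len_dist_mul (h : ExchangeSystem S) (hK : K ⊆ S) {d : W} (hd : d ∈ minReps S K)
    (z : parabolic K) : len S (d * z) = len S d + len (within K K) z := by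
  rw [h.len_mul_of_mem_minReps hK hd, h.len_within hK]

/-- On the coset `d W_K` the length is that of `W_K` shifted by the constant `len S d`, and `J ⊆ K`
keeps `d z s` in this coset. -/
theorem dist_mul_mem_minReps_iff (h : ExchangeSystem S) (hK : K ⊆ S) (hJ : J ⊆ K) {d : W}
    (hd : d ∈ minReps S K) (z : parabolic K) :
    d * z ∈ minReps S J ↔ z ∈ minReps (within K K) (within K J) := by
  constructor
  · intro hz s hs
    have := hz s hs
    rw [mul_assoc, ← Subgroup.coe_mul, len_dist_mul h hK hd, len_dist_mul h hK hd] at this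
    omega
  · intro hz s hs
    have := hz ⟨s, Subgroup.subset_closure (hJ hs)⟩ hs
    have e : d * z * s = d * ((z * ⟨s, Subgroup.subset_closure (hJ hs)⟩ : parabolic K) : W) := by
      rw [Subgroup.coe_mul, mul_assoc]
    rw [e, len_dist_mul h hK hd, len_dist_mul h hK hd]
    omega

theorem dist_mul_mem_inducedIdeal_iff (h : ExchangeSystem S) (hK : K ⊆ S) {d : W}
    (hd : d ∈ minReps S K) (z : parabolic K) : d * z ∈ inducedIdeal S K I₀ ↔ z ∈ I₀ := by
  constructor
  · rintro ⟨d', hd', z', hz', e⟩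
    obtain ⟨-, rfl⟩ := h.eq_of_mul_eq_mul hK hd hd' e
    exact hz'
  · exact fun hz => ⟨d, hd, z, hz, rfl⟩

/-- By Deodhar's lemma a step down from `d z` leads either to `(s d) z` with `s d ∈ D_K`, or to `d
(t z)` with `t z` below `z` in `W_K`. -/
theorem isWeakIdeal_inducedIdeal (h : ExchangeSystem S) (hK : K ⊆ S)
    (hI₀ : IsWeakIdeal (within K K) I₀) : IsWeakIdeal S (inducedIdeal S K I₀) := by
  refine isWeakIdeal_of_step fun u s hs hl => ?_
  rintro ⟨d, hd, z, hz, e⟩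
  obtain rfl : u = s * (d * z) := by rw [← e, h.mul_cancel_left ⟨s, hs⟩]
  rcases h.simple_mul_mem_minReps_or hK hd ⟨s, hs⟩ with h1 | ⟨t, ht⟩
  · exact ⟨_, h1, z, hz, (mul_assoc _ _ _).symm⟩
  · dsimp only at ht
    rw [h.mul_cancel_left ⟨s, hs⟩] at hl
    rw [← mul_assoc, ht, mul_assoc, ← Subgroup.coe_mul] at hl ⊢
    rw [len_dist_mul h hK hd, len_dist_mul h hK hd] at hl
    rw [dist_mul_mem_inducedIdeal_iff h hK hd]
    refine hI₀.mem_of_simple_mul t.2 ?_ ?_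
    · rw [(h.within_self hK).mul_cancel_left]
      omega
    · rwa [(h.within_self hK).mul_cancel_left]

theorem subset_posSet_inducedIdeal (h : ExchangeSystem S) (hK : K ⊆ S) (hJ : J ⊆ K)
    (hpos : within K J ⊆ posSet (within K K) I₀) : J ⊆ posSet S (inducedIdeal S K I₀) := by
  refine fun s hs => ⟨hK (hJ hs), ?_⟩
  rintro _ ⟨d, hd, z, hz, rfl⟩
  refine (dist_mul_mem_minReps_iff h hK hJ hd z).2 (fun t ht => ?_) s hs
  exact (hpos ht).2 z hz

/-- Left multiplication by `d` replaces a reflection `t` by its conjugate `d t d⁻¹` and shifts all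
lengths by the same constant, so chains go to chains. -/
theorem bruhatLT_dist_mul (h : ExchangeSystem S) (hK : K ⊆ S) {d : W} (hd : d ∈ minReps S K)
    {y z : parabolic K} (hyz : BruhatLT (within K K) y z) : BruhatLT S (d * y) (d * z) := by
  obtain ⟨h1, h2⟩ := hyz
  refine ⟨?_, fun e => h2 (Subtype.ext (mul_left_cancel e))⟩
  refine Relation.TransGen.lift (fun y : parabolic K => d * (y : W)) ?_ _ _ h1
  rintro x _ ⟨hl, t, ht, rfl⟩
  refine ⟨?_, d * (t : W) * d⁻¹, ?_, by simp [mul_assoc]⟩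
  · rw [len_dist_mul h hK hd, len_dist_mul h hK hd]
    omega
  · rcases ht with ⟨s, hs, w, rfl⟩ | rfl
    · exact .inl ⟨s, hK hs, (w : W) * d⁻¹, by simp [mul_assoc]⟩
    · right; simp

variable {𝒮₀ : Type v} [AddCommGroup 𝒮₀] [Module ℤ[T;T⁻¹] 𝒮₀]
  [Module (Hecke (within K K)) 𝒮₀]

/-- Lengths add in `s d` and in `d t`, hence `T_s T_d = T_{sd} = T_{dt} = T_d T_t`. -/
theorem gen_smul_indMk_of_eq (h : ExchangeSystem S) (hK : K ⊆ S) {d : W} (hd : d ∈ minReps S K)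
    {s : S} {t : within K K} (ht : (s : W) * d = d * (t : parabolic K)) (m : 𝒮₀) :
    gen S s • indMk hK (h.tw d) m = indMk hK (h.tw d) (gen (within K K) t • m) := by
  have hlt : len S d < len S (s * d) := by rw [ht]; exact hd _ t.2
  rw [smul_indMk, h.gen_mul_tw_of_lt hlt, ← indMk_mul, ht, gen_inclGen,
    ← h.tw_simple, h.len_mul_of_mem_minReps hK hd _ |> h.tw_mul]
  rfl

variable [IsScalarTower ℤ[T;T⁻¹] (Hecke (within K K)) 𝒮₀]

theorem indBasis_eq (h : ExchangeSystem S) (hK : K ⊆ S) (b : Module.Basis I₀ ℤ[T;T⁻¹] 𝒮₀)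
    {d : W} (hd : d ∈ minReps S K) {z : parabolic K} (hz : z ∈ I₀) {w : W}
    (hw : w ∈ inducedIdeal S K I₀) (e : w = d * z) :
    indBasis h hK b ⟨w, hw⟩ = indMk hK (h.tw d) (b ⟨z, hz⟩) := by
  subst e
  exact indBasis_apply h hK b ⟨d, hd⟩ ⟨z, hz⟩ hw

/-- Each formula splits by Deodhar's lemma. If `s d ∈ D_K`, then `s d z` is again in the induced
ideal, so weak ascents and descents do not occur, and the rule for `T_s T_d` gives the rest. If `s d
= d t`, then `s` is for `d z` of the same type as `t` for `z`, and the formula is the image of the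
one for `t` under `m ↦ T_d ⊗ m`. -/
theorem isWGraphIdealBasis_indBasis (h : ExchangeSystem S) (hK : K ⊆ S) (hJ : J ⊆ K)
    (hpos : within K J ⊆ posSet (within K K) I₀) {b : Module.Basis I₀ ℤ[T;T⁻¹] 𝒮₀}
    (hb : IsWGraphIdealBasis (within K K) I₀ (within K J) b) :
    IsWGraphIdealBasis S (inducedIdeal S K I₀) J (indBasis h hK b) where
  strong_ascent := by
    rintro s ⟨w, hw⟩ ⟨-, h1, h2⟩
    obtain ⟨d, hd, z, hz, rfl⟩ := id hw
    dsimp only at h1 h2 ⊢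
    refine ⟨h2, ?_⟩
    rw [indBasis_eq h hK b hd hz hw rfl]
    rw [bruhatLT_simple_mul_iff h s.2] at h1
    rcases h.simple_mul_mem_minReps_or hK hd s with h3 | ⟨t, ht⟩
    · rw [indBasis_eq h hK b h3 hz h2 (mul_assoc _ _ _).symm, smul_indMk, h.gen_mul_tw_of_lt]
      rw [← mul_assoc, len_dist_mul h hK hd, len_dist_mul h hK h3] at h1
      omega
    · have e : (s : W) * (d * z) = d * ((t * z : parabolic K) : W) := by
        rw [← mul_assoc, ht, Subgroup.coe_mul, mul_assoc]
      have h4 : (t : parabolic K) * z ∈ I₀ := by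
        rw [← dist_mul_mem_inducedIdeal_iff h hK hd, ← e]; exact h2
      have h5 : BruhatLT (within K K) z (t * z) := by
        rw [bruhatLT_simple_mul_iff (h.within_self hK) t.2]
        rw [e, len_dist_mul h hK hd, len_dist_mul h hK hd] at h1
        omega
      obtain ⟨_, h6⟩ := hb.strong_ascent t ⟨z, hz⟩ ⟨t.2, h5, h4⟩
      rw [gen_smul_indMk_of_eq h hK hd ht, h6, indBasis_eq h hK b hd h4 h2 e]
  strong_descent := by
    rintro s ⟨w, hw⟩ ⟨-, h1⟩
    obtain ⟨d, hd, z, hz, rfl⟩ := id hw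
    dsimp only at h1 ⊢
    rw [indBasis_eq h hK b hd hz hw rfl]
    rw [bruhatLT_simple_mul_iff' h s.2] at h1
    rcases h.simple_mul_mem_minReps_or hK hd s with h3 | ⟨t, ht⟩
    · have h2 : (s : W) * (d * z) ∈ inducedIdeal S K I₀ := ⟨_, h3, z, hz, (mul_assoc _ _ _).symm⟩
      refine ⟨h2, ?_⟩
      rw [indBasis_eq h hK b h3 hz h2 (mul_assoc _ _ _).symm, smul_indMk, h.gen_mul_tw_of_gt,
        indMk_add_left, indMk_smul_left]
      rw [← mul_assoc, len_dist_mul h hK hd, len_dist_mul h hK h3] at h1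
      omega
    · have e : (s : W) * (d * z) = d * ((t * z : parabolic K) : W) := by
        rw [← mul_assoc, ht, Subgroup.coe_mul, mul_assoc]
      have h5 : BruhatLT (within K K) (t * z) z := by
        rw [bruhatLT_simple_mul_iff' (h.within_self hK) t.2]
        rw [e, len_dist_mul h hK hd, len_dist_mul h hK hd] at h1
        omega
      obtain ⟨h4, h6⟩ := hb.strong_descent t ⟨z, hz⟩ ⟨t.2, h5⟩
      have h2 : (s : W) * (d * z) ∈ inducedIdeal S K I₀ := ⟨d, hd, _, h4, e⟩
      refine ⟨h2, ?_⟩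
      rw [gen_smul_indMk_of_eq h hK hd ht, h6, indBasis_eq h hK b hd h4 h2 e, ← indMkₗ_apply,
        map_add, map_smul]
      rfl
  weak_descent := by
    rintro s ⟨w, hw⟩ ⟨-, h1, h2⟩
    obtain ⟨d, hd, z, hz, rfl⟩ := id hw
    dsimp only at h1 h2 ⊢
    rw [indBasis_eq h hK b hd hz hw rfl]
    rw [bruhatLT_simple_mul_iff h s.2] at h1
    rcases h.simple_mul_mem_minReps_or hK hd s with h3 | ⟨t, ht⟩
    -- By `hpos`, `z` lies in `D_J`, hence so does `(s d) z`.
    · refine absurd ?_ h2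
      rw [← mul_assoc, dist_mul_mem_minReps_iff h hK hJ h3]
      exact fun t ht => (hpos ht).2 z hz
    · have e : (s : W) * (d * z) = d * ((t * z : parabolic K) : W) := by
        rw [← mul_assoc, ht, Subgroup.coe_mul, mul_assoc]
      have h5 : BruhatLT (within K K) z (t * z) := by
        rw [bruhatLT_simple_mul_iff (h.within_self hK) t.2]
        rw [e, len_dist_mul h hK hd, len_dist_mul h hK hd] at h1
        omega
      have h4 : (t : parabolic K) * z ∉ minReps (within K K) (within K J) := by
        rw [← dist_mul_mem_minReps_iff h hK hJ hd, ← e]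
        exact h2
      rw [gen_smul_indMk_of_eq h hK hd ht, hb.weak_descent t ⟨z, hz⟩ ⟨t.2, h5, h4⟩,
        ← indMkₗ_apply, map_smul]
      rfl
  weak_ascent := by
    rintro s ⟨w, hw⟩ ⟨-, h1, h2, h7⟩
    obtain ⟨d, hd, z, hz, rfl⟩ := id hw
    dsimp only at h1 h2 h7 ⊢
    rw [indBasis_eq h hK b hd hz hw rfl]
    rw [bruhatLT_simple_mul_iff h s.2] at h1
    rcases h.simple_mul_mem_minReps_or hK hd s with h3 | ⟨t, ht⟩
    · exact absurd ⟨_, h3, z, hz, (mul_assoc _ _ _).symm⟩ h7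
    · have e : (s : W) * (d * z) = d * ((t * z : parabolic K) : W) := by
        rw [← mul_assoc, ht, Subgroup.coe_mul, mul_assoc]
      have h5 : BruhatLT (within K K) z (t * z) := by
        rw [bruhatLT_simple_mul_iff (h.within_self hK) t.2]
        rw [e, len_dist_mul h hK hd, len_dist_mul h hK hd] at h1
        omega
      have h4 : (t : parabolic K) * z ∈ minReps (within K K) (within K J) := by
        rw [← dist_mul_mem_minReps_iff h hK hJ hd, ← e]
        exact h2
      have h8 : (t : parabolic K) * z ∉ I₀ := by
        rw [← dist_mul_mem_inducedIdeal_iff h hK hd, ← e]; exact h7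
      obtain ⟨r, hr1, hr2, hr3⟩ := hb.weak_ascent t ⟨z, hz⟩ ⟨t.2, h5, h4, h8⟩
      -- The polynomials are those of `t` at `z`, transported along `y ↦ d y` and extended by zero.
      let f : I₀ ↪ inducedIdeal S K I₀ :=
        ⟨fun y => ⟨d * (y : parabolic K), d, hd, y, y.2, rfl⟩, fun y y' hyy =>
          Subtype.ext (Subtype.ext (mul_left_cancel (congrArg Subtype.val hyy)))⟩
      refine ⟨r.embDomain f, ?_, ?_, ?_⟩
      · intro y hy
        rw [Finsupp.support_embDomain, Finset.mem_map] at hy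
        obtain ⟨x, hx, rfl⟩ := hy
        rw [e]
        exact bruhatLT_dist_mul h hK hd (hr1 x hx)
      · intro y
        by_cases hy : y ∈ Set.range f
        · obtain ⟨x, rfl⟩ := hy
          rw [Finsupp.embDomain_apply_self]
          exact hr2 x
        · rw [Finsupp.embDomain_of_notMem_range _ _ _ hy, Polynomial.coeff_zero]
      · rw [gen_smul_indMk_of_eq h hK hd ht, hr3, ← indMkₗ_apply, map_sub, map_smul,
          Finsupp.sum_embDomain, map_finsuppSum]
        congr 1
        refine Finsupp.sum_congr fun y hy => ?_
        rw [map_smul, indMkₗ_apply]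
        congr 1
        exact (indBasis_eq h hK b hd y.2 _ rfl).symm
  involution := by
    obtain ⟨β, hinv, ⟨h1, hβ1⟩, hβ⟩ := hb.involution
    have hd : (1 : W) ∈ minReps S K := fun s hs => by
      rw [one_mul, len_one, h.len_simple ⟨s, hK hs⟩]
      exact Nat.one_pos
    have h2 : (1 : W) ∈ inducedIdeal S K I₀ := ⟨1, hd, 1, h1, by simp⟩
    refine ⟨indBar hK β hβ, indBar_involutive hK β hβ hinv, ⟨h2, ?_⟩, indBar_smul hK β hβ⟩
    rw [indBasis_eq h hK b hd h1 h2 (by simp), indBar_indMk, hβ1, h.tw_one, map_one]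

end InducedIdeal
-- Uniqueness of the associated module.
section Uniqueness

theorem barA_eq_invert (a : ℤ[T;T⁻¹]) : barA a = LaurentPolynomial.invert a := rfl

/-- Invariance means that the reverse of `p` is `p` times `X ^ p.natDegree`. Reversal does not raise
the degree, so `p` is constant, and the constant is 0. -/
theorem eq_zero_of_barA_toLaurent_eq {p : ℤ[X]} (h0 : p.coeff 0 = 0)
    (hp : barA (Polynomial.toLaurent p) = Polynomial.toLaurent p) : p = 0 := by
  have h1 := LaurentPolynomial.toLaurent_reverse p
  rw [← barA_eq_invert, hp, ← Polynomial.toLaurent_X_pow, ← map_mul] at h1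
  have h2 := Polynomial.toLaurent_injective h1
  by_contra hne
  have h3 : p.reverse.natDegree ≤ p.natDegree := Polynomial.reverse_natDegree_le p
  rw [h2, Polynomial.natDegree_mul_X_pow _ hne] at h3
  rw [Polynomial.eq_C_of_natDegree_eq_zero (p := p) (by omega), h0, Polynomial.C_0] at hne
  exact hne rfl

variable {G : Type u} [Group G] {S I J : Set G}
  {𝒮 : Type v} [AddCommGroup 𝒮] [Module ℤ[T;T⁻¹] 𝒮]

/-- The span of the basis elements of length less than `n`. -/
noncomputable def lowSpan (b : Module.Basis I ℤ[T;T⁻¹] 𝒮) (n : ℕ) : Submodule ℤ[T;T⁻¹] 𝒮 :=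
  Submodule.span _ (b '' {y | len S (y : G) < n})

theorem basis_mem_lowSpan (b : Module.Basis I ℤ[T;T⁻¹] 𝒮) {n : ℕ} {y : I}
    (hy : len S (y : G) < n) : b y ∈ lowSpan (S := S) b n :=
  Submodule.subset_span ⟨y, hy, rfl⟩

theorem lowSpan_mono (b : Module.Basis I ℤ[T;T⁻¹] 𝒮) {m n : ℕ} (hmn : m ≤ n) :
    lowSpan (S := S) b m ≤ lowSpan (S := S) b n :=
  Submodule.span_mono (Set.image_mono fun _ hy => lt_of_lt_of_le hy hmn)

theorem repr_eq_zero_of_mem_lowSpan (b : Module.Basis I ℤ[T;T⁻¹] 𝒮) {n : ℕ} {x : 𝒮}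
    (hx : x ∈ lowSpan (S := S) b n) {y : I} (hy : n ≤ len S (y : G)) : b.repr x y = 0 := by
  rw [lowSpan, Module.Basis.mem_span_image] at hx
  by_contra hne
  have : len S (y : G) < n := hx (Finsupp.mem_support_iff.2 hne)
  omega

variable [Module (Hecke S) 𝒮]

theorem exists_simple_mul_eq (h : ExchangeSystem S) (hI : IsWeakIdeal S I) (w : I)
    (hw : (w : G) ≠ 1) :
    ∃ (s : S) (u : I), (s : G) * u = w ∧ len S (w : G) = len S (u : G) + 1 := by
  obtain ⟨w, hwI⟩ := w
  dsimp only at hw ⊢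
  obtain ⟨ω, h1, rfl⟩ := h.exists_isRed w
  cases ω with
  | nil => exact absurd rfl hw
  | cons s ω =>
    have h2 : len S (wprod (s :: ω)) = len S (wprod ω) + 1 := by
      rw [h1, h1.tail h, List.length_cons]
    refine ⟨s, ⟨wprod ω, hI.mem_of_simple_mul s.2 ?_ ?_⟩, (wprod_cons s ω).symm, h2⟩
    · rw [← wprod_cons, h2]
      exact Nat.le_succ _
    · rwa [← wprod_cons]

namespace IsWGraphIdealBasis

theorem gen_smul_of_mul_eq {b : Module.Basis I ℤ[T;T⁻¹] 𝒮} (hb : IsWGraphIdealBasis S I J b)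
    (h : ExchangeSystem S) {s : S} {u w : I} (hsu : (s : G) * u = w)
    (hl : len S (w : G) = len S (u : G) + 1) : gen S s • b u = b w := by
  obtain ⟨hmem, h1⟩ := hb.strong_ascent s u ⟨s.2, (bruhatLT_simple_mul_iff h s.2 _).2 (by
    rw [hsu, hl]; exact Nat.lt_succ_self _), hsu ▸ w.2⟩
  rw [h1]
  congr 1
  exact Subtype.ext hsu

/-- Length `len S w + 1` is reached by strong ascents; in a weak ascent the `y` lie below `s w` and
so have smaller length than `s w`, by `hlt`. -/
theorem gen_smul_basis_mem_lowSpan {b : Module.Basis I ℤ[T;T⁻¹] 𝒮}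
    (hb : IsWGraphIdealBasis S I J b) (h : ExchangeSystem S)
    (hlt : ∀ u w, BruhatLT S u w → len S u < len S w) (s : S) (w : I) :
    gen S s • b w ∈ lowSpan (S := S) b (len S (w : G) + 2) := by
  have h1 := h.len_simple_mul (w : G) s
  have hw : b w ∈ lowSpan (S := S) b (len S (w : G) + 2) := basis_mem_lowSpan b (by omega)
  by_cases h2 : len S (w : G) < len S (s * w)
  · have h3 := (bruhatLT_simple_mul_iff h s.2 (w : G)).2 h2
    by_cases h4 : (s : G) * w ∈ I
    · obtain ⟨h5, h6⟩ := hb.strong_ascent s w ⟨s.2, h3, h4⟩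
      rw [h6]
      exact basis_mem_lowSpan b (by dsimp only; omega)
    · by_cases h5 : (s : G) * w ∈ minReps S J
      · obtain ⟨r, hr, -, h6⟩ := hb.weak_ascent s w ⟨s.2, h3, h5, h4⟩
        rw [h6]
        refine Submodule.sub_mem _ (Submodule.smul_mem _ _ hw) (Submodule.sum_mem _ fun y hy => ?_)
        refine Submodule.smul_mem _ _ (basis_mem_lowSpan b ?_)
        have := hlt _ _ (hr y hy)
        omega
      · rw [hb.weak_descent s w ⟨s.2, h3, h5⟩]
        exact Submodule.smul_mem _ _ hw
  · obtain ⟨h5, h6⟩ := hb.strong_descent s w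
      ⟨s.2, (bruhatLT_simple_mul_iff' h s.2 (w : G)).2 (by omega)⟩
    rw [h6]
    exact Submodule.add_mem _ (basis_mem_lowSpan b (by dsimp only; omega))
      (Submodule.smul_mem _ _ hw)

end IsWGraphIdealBasis

variable [IsScalarTower ℤ[T;T⁻¹] (Hecke S) 𝒮]

theorem smul_comm_of_tower (r : ℤ[T;T⁻¹]) (a : Hecke S) (x : 𝒮) : a • r • x = r • a • x := by
  rw [← algebraMap_smul (Hecke S) r x, ← algebraMap_smul (Hecke S) r (a • x), smul_smul, smul_smul,
    Algebra.commutes]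

theorem bar_gen_smul (s : S) (x : 𝒮) :
    bar S (gen S s) • x = gen S s • x - (q - qinv) • x := by
  rw [bar_gen, sub_smul, smul_assoc, one_smul]

namespace IsWGraphIdealBasis

theorem gen_smul_mem_lowSpan {b : Module.Basis I ℤ[T;T⁻¹] 𝒮}
    (hb : IsWGraphIdealBasis S I J b) (h : ExchangeSystem S)
    (hlt : ∀ u w, BruhatLT S u w → len S u < len S w) (s : S) {n : ℕ} {x : 𝒮}
    (hx : x ∈ lowSpan (S := S) b n) : gen S s • x ∈ lowSpan (S := S) b (n + 1) := by
  induction hx using Submodule.span_induction with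
  | mem x hx =>
    obtain ⟨y, hy, rfl⟩ := hx
    replace hy : len S (y : G) < n := hy
    exact lowSpan_mono b (by omega) (hb.gen_smul_basis_mem_lowSpan h hlt s y)
  | zero => simp
  | add x y _ _ hx hy => rw [smul_add]; exact Submodule.add_mem _ hx hy
  | smul r x _ hx => rw [smul_comm_of_tower]; exact Submodule.smul_mem _ _ hx

/-- The semilinear involution is unitriangular. -/
theorem bar_basis_sub_mem_lowSpan {b : Module.Basis I ℤ[T;T⁻¹] 𝒮}
    (hb : IsWGraphIdealBasis S I J b) (h : ExchangeSystem S)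
    (hlt : ∀ u w, BruhatLT S u w → len S u < len S w) (hI : IsWeakIdeal S I)
    {β : 𝒮 →ₛₗ[barA] 𝒮} (hβ1 : ∀ h1 : (1 : G) ∈ I, β (b ⟨1, h1⟩) = b ⟨1, h1⟩)
    (hβ : ∀ (a : Hecke S) (x : 𝒮), β (a • x) = bar S a • β x) (w : I) :
    β (b w) - b w ∈ lowSpan (S := S) b (len S (w : G)) := by
  obtain ⟨n, hn⟩ : ∃ n, len S (w : G) = n := ⟨_, rfl⟩
  induction n generalizing w with
  | zero =>
    obtain ⟨w, hw⟩ := w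
    obtain rfl := h.eq_one_of_len_eq_zero hn
    rw [hβ1, sub_self]
    exact Submodule.zero_mem _
  | succ n ih =>
    obtain ⟨s, u, hsu, hl⟩ := exists_simple_mul_eq h hI w (by
      intro e; rw [e, len_one] at hn; omega)
    have h1 := ih u (by omega)
    have h2 := hb.gen_smul_of_mul_eq h hsu hl
    have h3 := hb.gen_smul_mem_lowSpan h hlt s h1
    -- With `b w = T_s b_u` and `bar T_s = T_s - (q - q⁻¹)`, the terms `T_s b_u` cancel and only
    -- lengths below that of `w` remain.
    have h4 : β (b w) - b w = gen S s • (β (b u) - b u) -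
        (q - qinv) • (β (b u) - b u) - (q - qinv) • b u := by
      rw [← h2, hβ, bar_gen_smul, smul_sub (gen S s), smul_sub (q - qinv)]
      abel
    rw [h4, hl]
    exact Submodule.sub_mem _ (Submodule.sub_mem _ h3 (Submodule.smul_mem _ _
      (lowSpan_mono b (Nat.le_succ _) h1))) (Submodule.smul_mem _ _
      (basis_mem_lowSpan b (Nat.lt_succ_self _)))

/-- At an index of maximal length in the support, unitriangularity makes the coefficient itself bar
invariant, and no nonzero element of `q ℤ[q]` is. -/
theorem eq_zero_of_bar_eq {b : Module.Basis I ℤ[T;T⁻¹] 𝒮}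
    (hb : IsWGraphIdealBasis S I J b) (h : ExchangeSystem S)
    (hlt : ∀ u w, BruhatLT S u w → len S u < len S w) (hI : IsWeakIdeal S I)
    {β : 𝒮 →ₛₗ[barA] 𝒮} (hβ1 : ∀ h1 : (1 : G) ∈ I, β (b ⟨1, h1⟩) = b ⟨1, h1⟩)
    (hβ : ∀ (a : Hecke S) (x : 𝒮), β (a • x) = bar S a • β x)
    {r : I →₀ ℤ[X]} (hr : ∀ y, (r y).coeff 0 = 0)
    (hfix : β (r.sum fun y p => Polynomial.toLaurent p • b y) =
      r.sum fun y p => Polynomial.toLaurent p • b y) : r = 0 := by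
  by_contra hne
  obtain ⟨y, hy, hmax⟩ := r.support.exists_max_image (fun y => len S (y : G))
    (Finsupp.support_nonempty_iff.2 hne)
  refine Finsupp.mem_support_iff.1 hy (eq_zero_of_barA_toLaurent_eq (hr y) ?_)
  have h1 := congrArg (fun x => b.repr x y) hfix
  simp only [Finsupp.sum, map_sum, Finsupp.coe_finsetSum, Finset.sum_apply, map_smulₛₗ,
    Finsupp.smul_apply, smul_eq_mul, RingHom.id_apply] at h1
  have h2 : ∀ z ∈ r.support, b.repr (β (b z)) y = b.repr (b z) y := by
    intro z hz
    have h3 := repr_eq_zero_of_mem_lowSpan b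
      (hb.bar_basis_sub_mem_lowSpan h hlt hI hβ1 hβ z) (hmax z hz)
    rwa [map_sub, Finsupp.sub_apply, sub_eq_zero] at h3
  rw [Finset.sum_congr rfl fun z hz => by rw [h2 z hz]] at h1
  rw [Finset.sum_eq_single_of_mem y hy, Finset.sum_eq_single_of_mem y hy] at h1
  · simpa using h1
  · intro z _ hz
    simp [Finsupp.single_eq_of_ne' hz]
  · intro z _ hz
    simp [Finsupp.single_eq_of_ne' hz]

/-- The element `q - T_s` of `ℋ` is bar invariant, so its action commutes with `β`. -/
theorem bar_eq_of_gen_smul_eq {β : 𝒮 →ₛₗ[barA] 𝒮}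
    (hβ : ∀ (a : Hecke S) (x : 𝒮), β (a • x) = bar S a • β x) {s : S} {x y : 𝒮}
    (hxy : gen S s • x = q • x - y) : β y = q • β x - gen S s • β x := by
  have h1 := congrArg β hxy
  rw [hβ, bar_gen_smul, map_sub, map_smulₛₗ, barA_q, sub_smul] at h1
  rw [← sub_eq_zero] at h1 ⊢
  rw [← h1]
  abel

variable {𝒮' : Type w} [AddCommGroup 𝒮'] [Module ℤ[T;T⁻¹] 𝒮'] [Module (Hecke S) 𝒮']
  [IsScalarTower ℤ[T;T⁻¹] (Hecke S) 𝒮']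

/-- Only weak ascents need an argument. There the sum is `(q - T_s) b_w`, and applying the
involution changes it by `(q - T_s) (β b_w - b_w)`. This involves only basis elements shorter than
`w` under `T_s`, where `θ` is already known to commute with the generators. So the two sums change
by the same amount, and their difference in `𝒮'` is bar invariant with coefficients in `q ℤ[q]`. -/
theorem equiv_gen_smul {b : Module.Basis I ℤ[T;T⁻¹] 𝒮} {b' : Module.Basis I ℤ[T;T⁻¹] 𝒮'}
    (hb : IsWGraphIdealBasis S I J b) (hb' : IsWGraphIdealBasis S I J b') (h : ExchangeSystem S)
    (hlt : ∀ u w, BruhatLT S u w → len S u < len S w) (hI : IsWeakIdeal S I) (s : S) (w : I) :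
    b.equiv b' (Equiv.refl I) (gen S s • b w) = gen S s • b' w := by
  obtain ⟨β, -, ⟨hone, hβ1⟩, hβ⟩ := hb.involution
  obtain ⟨β', -, ⟨_, hβ1'⟩, hβ'⟩ := hb'.involution
  set θ := b.equiv b' (Equiv.refl I) with hθ
  have θb : ∀ y, θ (b y) = b' y := fun y => by simp [hθ]
  obtain ⟨n, hn⟩ : ∃ n, len S (w : G) < n := ⟨_, Nat.lt_succ_self _⟩
  induction n generalizing s w with
  | zero => omega
  | succ n ih =>
    have hlow : ∀ x ∈ lowSpan (S := S) b n, ∀ s, θ (gen S s • x) = gen S s • θ x := by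
      intro x hx s
      induction hx using Submodule.span_induction with
      | mem x hx =>
        obtain ⟨y, hy, rfl⟩ := hx
        rw [ih s y hy, θb]
      | zero => simp
      | add x y _ _ hx hy => rw [smul_add, map_add, map_add, hx, hy, smul_add]
      | smul r x _ hx =>
        rw [smul_comm_of_tower, map_smul θ r, map_smul θ r, hx, smul_comm_of_tower]
    have hmem := hb.bar_basis_sub_mem_lowSpan h hlt hI (fun _ => hβ1) hβ
    -- The bound is `k ≤ n` and so includes `w` itself: for `y = t u`, only the action of `T_t` on
    -- `β (b u)` is needed, which involves lengths below `n`.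
    have hbar : ∀ k, ∀ y : I, len S (y : G) = k → k ≤ n → θ (β (b y)) = β' (b' y) := by
      intro k
      induction k with
      | zero =>
        rintro ⟨y, hy⟩ hk -
        obtain rfl := h.eq_one_of_len_eq_zero hk
        rw [hβ1, hβ1', θb]
      | succ k ihk =>
        intro y hk hkn
        obtain ⟨t, u, htu, hl⟩ := exists_simple_mul_eq h hI y (by
          intro e; rw [e, len_one] at hk; omega)
        have hu : β (b u) ∈ lowSpan (S := S) b n := by
          have h1 := Submodule.add_mem _ (lowSpan_mono b (n := n) (by omega) (hmem u))
            (basis_mem_lowSpan b (n := n) (y := u) (by omega))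
          rwa [sub_add_cancel] at h1
        rw [← hb.gen_smul_of_mul_eq h htu hl, ← hb'.gen_smul_of_mul_eq h htu hl, hβ, hβ',
          bar_gen_smul, bar_gen_smul, map_sub, hlow _ hu, map_smul, ihk u (by omega) (by omega)]
    have h1 := h.len_simple_mul (w : G) s
    by_cases h2 : len S (w : G) < len S (s * w)
    · have h3 := (bruhatLT_simple_mul_iff h s.2 (w : G)).2 h2
      by_cases h4 : (s : G) * w ∈ I
      · obtain ⟨_, h6⟩ := hb.strong_ascent s w ⟨s.2, h3, h4⟩
        obtain ⟨_, h6'⟩ := hb'.strong_ascent s w ⟨s.2, h3, h4⟩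
        rw [h6, h6', θb]
      by_cases h5 : (s : G) * w ∈ minReps S J
      · obtain ⟨r, hr, hr0, h6⟩ := hb.weak_ascent s w ⟨s.2, h3, h5, h4⟩
        obtain ⟨r', hr', hr0', h6'⟩ := hb'.weak_ascent s w ⟨s.2, h3, h5, h4⟩
        have hX : r = r' := by
          have hw := hbar _ w rfl (by omega)
          have e1 := bar_eq_of_gen_smul_eq hβ h6
          have e1' := bar_eq_of_gen_smul_eq hβ' h6'
          have e2 : (r.sum fun y p => Polynomial.toLaurent p • b y) = q • b w - gen S s • b w := by
            rw [h6, sub_sub_cancel]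
          have e2' : (r'.sum fun y p => Polynomial.toLaurent p • b' y) =
              q • b' w - gen S s • b' w := by
            rw [h6', sub_sub_cancel]
          -- On `b w` itself `θ` is not yet known to commute with `T_s`, but by unitriangularity `β
          -- (b w) - b w` is of lower length.
          have e3 := hlow _ (lowSpan_mono b (by omega) (hmem w)) s
          have e4 : θ (r.sum fun y p => Polynomial.toLaurent p • b y) =
              r.sum fun y p => Polynomial.toLaurent p • b' y := by
            simp only [map_finsuppSum, map_smul, θb]
          have e5 : β' (θ (r.sum fun y p => Polynomial.toLaurent p • b y)) =
              θ (β (r.sum fun y p => Polynomial.toLaurent p • b y)) := by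
            rw [e4]
            simp only [map_finsuppSum, map_smulₛₗ, RingHom.id_apply]
            refine Finsupp.sum_congr fun y hy => ?_
            have := hlt _ _ (hr y hy)
            rw [hbar _ y rfl (by omega)]
          refine sub_eq_zero.1 (hb'.eq_zero_of_bar_eq h hlt hI (fun _ => hβ1') hβ'
            (r := r - r') (fun y => by simp [hr0, hr0']) ?_)
          rw [Finsupp.sum_sub_index (fun y p p' => by rw [map_sub, sub_smul]), map_sub, ← e4, e5,
            e1, e1', e2, e2']
          simp only [smul_sub, map_sub, map_smul, θb, hw] at e3 ⊢
          rw [sub_eq_iff_eq_add] at e3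
          rw [e3]
          abel
        rw [h6, h6', hX, map_sub, map_smul, θb]
        simp only [map_finsuppSum, map_smul, θb]
      · rw [hb.weak_descent s w ⟨s.2, h3, h5⟩, hb'.weak_descent s w ⟨s.2, h3, h5⟩, map_smul, θb]
    · have h3 := (bruhatLT_simple_mul_iff' h s.2 (w : G)).2 (by omega)
      obtain ⟨_, h6⟩ := hb.strong_descent s w ⟨s.2, h3⟩
      obtain ⟨_, h6'⟩ := hb'.strong_descent s w ⟨s.2, h3⟩
      rw [h6, h6', map_add, map_smul, θb, θb]

end IsWGraphIdealBasis
end Uniqueness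
/-- The module associated with an ideal `I` and a set `J` is unique up to isomorphism. -/
theorem IsWGraphIdealBasis.nonempty_linearEquiv {G : Type u} [Group G] {S I J : Set G}
    {𝒮 : Type v} [AddCommGroup 𝒮] [Module ℤ[T;T⁻¹] 𝒮] [Module (Hecke S) 𝒮]
    [IsScalarTower ℤ[T;T⁻¹] (Hecke S) 𝒮]
    {𝒮' : Type w} [AddCommGroup 𝒮'] [Module ℤ[T;T⁻¹] 𝒮'] [Module (Hecke S) 𝒮']
    [IsScalarTower ℤ[T;T⁻¹] (Hecke S) 𝒮']
    {b : Module.Basis I ℤ[T;T⁻¹] 𝒮} {b' : Module.Basis I ℤ[T;T⁻¹] 𝒮'}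
    (hb : IsWGraphIdealBasis S I J b) (hb' : IsWGraphIdealBasis S I J b') (h : ExchangeSystem S)
    (hlt : ∀ u w, BruhatLT S u w → len S u < len S w) (hI : IsWeakIdeal S I) :
    Nonempty (𝒮 ≃ₗ[Hecke S] 𝒮') := by
  let θ := b.equiv b' (Equiv.refl I)
  have hgen : ∀ (s : S) (x : 𝒮), θ (gen S s • x) = gen S s • θ x := by
    intro s x
    have hx := b.mem_span x
    induction hx using Submodule.span_induction with
    | zero => simp
    | add x y _ _ hx hy => rw [smul_add, map_add, map_add, hx, hy, smul_add]
    | smul r x _ hx => rw [smul_comm_of_tower, map_smul θ r, map_smul θ r, hx, smul_comm_of_tower]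
    | mem x hx =>
      obtain ⟨w, rfl⟩ := hx
      rw [hb.equiv_gen_smul hb' h hlt hI]
      simp [θ]
  have hsmul : ∀ (a : Hecke S) (x : 𝒮), θ (a • x) = a • θ x := by
    intro a
    have ha : a ∈ Algebra.adjoin ℤ[T;T⁻¹] (Set.range (gen S)) :=
      adjoin_range_gen S ▸ Algebra.mem_top
    induction ha using Algebra.adjoin_induction with
    | mem x hx => obtain ⟨s, rfl⟩ := hx; exact hgen s
    | algebraMap r => intro x; rw [algebraMap_smul, algebraMap_smul, map_smul]
    | add a c _ _ ha hc => intro x; rw [add_smul, map_add, ha, hc, add_smul]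
    | mul a c _ _ ha hc => intro x; rw [mul_smul, ha, hc, mul_smul]
  exact ⟨{ θ with map_smul' := hsmul }⟩

end WGraph

theorem mainTheorem3 {B : Type*} {W : Type*} [Group W] {M : CoxeterMatrix B}
    (cs : CoxeterSystem M W) (S : Set W) (hS : S = Set.range cs.simple)
    (K : Set W) (hK : K ⊆ S) (J : Set W) (hJ : J ⊆ K)
    (I₀ : Set (WGraph.parabolic K))
    (hI₀ : WGraph.IsWGraphIdeal (WGraph.within K K) I₀ (WGraph.within K J))
    (𝒮₀ : Type*) [AddCommGroup 𝒮₀] [Module ℤ[T;T⁻¹] 𝒮₀]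
    [Module (WGraph.Hecke (WGraph.within K K)) 𝒮₀]
    [IsScalarTower ℤ[T;T⁻¹] (WGraph.Hecke (WGraph.within K K)) 𝒮₀]
    (h𝒮₀ : WGraph.IsWGraphIdealModule (WGraph.within K K) I₀ (WGraph.within K J) 𝒮₀) :
    WGraph.IsWGraphIdeal S (WGraph.inducedIdeal S K I₀) J ∧
      WGraph.IsWGraphIdealModule S (WGraph.inducedIdeal S K I₀) J (WGraph.Induced hK 𝒮₀) ∧
      ∀ (𝒮 : Type*) [AddCommGroup 𝒮] [Module ℤ[T;T⁻¹] 𝒮] [Module (WGraph.Hecke S) 𝒮]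
        [IsScalarTower ℤ[T;T⁻¹] (WGraph.Hecke S) 𝒮],
        WGraph.IsWGraphIdealModule S (WGraph.inducedIdeal S K I₀) J 𝒮 →
          Nonempty (𝒮 ≃ₗ[WGraph.Hecke S] WGraph.Induced hK 𝒮₀) := by
  subst hS
  have h := WGraph.exchangeSystem_range_simple cs
  obtain ⟨hideal, hpos, 𝒮₁, _, _, _, _, b₁, hb₁⟩ := hI₀
  obtain ⟨b, hb⟩ := h𝒮₀
  have hind := WGraph.isWGraphIdealBasis_indBasis h hK hJ hpos hb
  have hI := WGraph.isWeakIdeal_inducedIdeal h hK hideal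
  -- A `W`-graph ideal requires a module in the universe of `W`, in which `𝒮₀` need not lie. The
  -- first claim therefore induces the module `𝒮₁` supplied by the hypothesis on `I₀`.
  refine ⟨⟨hI, WGraph.subset_posSet_inducedIdeal h hK hJ hpos, WGraph.Induced hK 𝒮₁,
    inferInstance, inferInstance, inferInstance, inferInstance, _,
    WGraph.isWGraphIdealBasis_indBasis h hK hJ hpos hb₁⟩, ⟨_, hind⟩, ?_⟩
  intro 𝒮 _ _ _ _ h𝒮
  obtain ⟨b', hb'⟩ := h𝒮
  exact hb'.nonempty_linearEquiv hind h (fun _ _ => WGraph.len_lt_of_bruhatLT cs) hI
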